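/- **Setting.** Let $n\ge 1$, let $\mathbf X=(X_1,\dots,X_n)$ (assets) and $\mathbf L=(L_1,\dots,L_n)$ (claim sizes) be independent random vectors on a probability space, with $X_i>0$ almost surely, $X_i$, $X_i^{-1}$, $L_i$, $\langle\mathbf X,\mathbf L\rangle$ integrable, $\mathbb E[X_i]=1$ and $\mathbb E[L_i]=0$. Assume that $\mathbf L$ has a bounded, strictly positive density $f_{\mathbf L}$ on $\mathbb R^n$ that is twice continuously differentiable and satisfies $\int(1+\|\ell\|^2)\,\|D^kf_{\mathbf L}(\ell)\|\,d\ell<\infty$ for $k=0,1,2$. Consider either the *normal* volatility $\sigma^*=\max_i\operatorname{Var}[X_i]^{1/2}$ (then assume $X_i\in L^2$ for all $i$) or the *log-normal* volatility $\sigma^*=\max_i\operatorname{Var}[\log X_i]^{1/2}$. Put $Y_i=(X_i-1)/\sigma^*$, respectively $Y_i=(\log X_i-\mathbb E[\log X_i])/\sigma^*$ (and $Y_i=0$ if $\sigma^*=0$), and let the version of the assets with volatility $\sigma$ be $X_{\sigma,i}=1+\sigma Y_i$, respectively $X_{\sigma,i}=e^{\sigma Y_i}/\mathbb E[e^{\sigma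 Y_i}]$. Let $\boldsymbol\Sigma=\boldsymbol\Sigma_\sigma$ be the covariance matrix of $\mathbf X_\sigma$, and for $\boldsymbol\phi\in\mathbb R^n$ let $$S_\sigma(\boldsymbol\phi)=\langle\mathbf X_\sigma-\mathbf 1,\boldsymbol\phi\rangle-\langle\mathbf X_\sigma,\mathbf L\rangle .$$ For a random variable $Z$ let $\mathrm{VaR}_\alpha[Z]=\inf\{m:\mathbb P(Z+m<0)\le\alpha\}$. Let $f$ be the derivative of the distribution function of $\langle\mathbf 1,\mathbf L\rangle$, let $\mathbf K(y)=\mathbb E[\mathbf L\,1_{\langle\mathbf 1,\mathbf L\rangle>y}]$, and for a random vector $\mathbf Z$ let $K[\mathbf Z](y)=\mathbb E[\langle\mathbf Z,\boldsymbol\Sigma\mathbf Z\rangle 1_{\langle\mathbf 1,\mathbf L\rangle>y}]$. Let $\alpha\in(0,1)$ and $q=F^{-1}_{\langle\mathbf 1,\mathbf L\rangle}(1-\alpha)=\inf\{y:\mathbb P(\langle\mathbf 1,\mathbf L\rangle\le y)\ge1-\alpha\}$. **Theorem.** One has $q=\mathrm{VaR}_\alpha[-\langle\mathbf 1,\mathbf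 L\rangle]$; $f$ is a strictly positive $C^1$ density of $\langle\mathbf 1,\mathbf L\rangle$; $\mathbf K$ and $K[\boldsymbol\phi-\mathbf L]$ are $C^2$, the latter for every $\boldsymbol\phi\in\mathbb R^n$ and also with any real $n\times n$ matrix in place of $\boldsymbol\Sigma$; and, for all sufficiently small $\sigma>0$, the $X_{\sigma,i}$ are almost surely positive, square integrable and of mean one, and $\mathbf X_\sigma$ has (normal, respectively log-normal) volatility $\sigma$ if $\sigma^*>0$. Moreover: a) For every $\boldsymbol\phi\in\mathbb R^n$, as $\sigma\downarrow0$, $$\mathrm{VaR}_\alpha[S_\sigma(\boldsymbol\phi)]=q+\frac1{2f(q)}K[\boldsymbol\phi-\mathbf L]''(q)+o(\sigma^2) =q-\frac1{2f(q)}\Big\{\langle\boldsymbol\phi,\boldsymbol\Sigma\boldsymbol\phi\rangle f'(q)+2\langle\boldsymbol\Sigma\boldsymbol\phi,\mathbf K''(q)\rangle-K[\mathbf L]''(q)\Big\}+o(\sigma^2),$$ and the two second-order expansions agree exactly, for every $\sigma$. b) Let $\sigma>0$ be such that the $X_{\sigma,i}$ are square integrable and $\boldsymbol\Sigma$ is invertible,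 and let $f'(q)\ne0$. Then $\boldsymbol\phi^*=-f'(q)^{-1}\mathbf K''(q)$ is the unique stationary point of the second-order expansion $\boldsymbol\phi\mapsto q+\frac1{2f(q)}K[\boldsymbol\phi-\mathbf L]''(q)$ on $\mathbb R^n$. If $f'(q)<0$, it is its unique global minimiser. If $f'(q)>0$, it is its unique global maximiser, and the expansion is unbounded below, so that there is no minimum. -/

import Mathlib

open MeasureTheory ProbabilityTheory Filter Topology Asymptotics Matrix

namespace SurplusRisk

noncomputable section

/-- The two ways of measuring the volatility of an asset. -/
inductive VolKind where
  | normal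
  | logNormal

/-- The quantity whose standard deviation is the volatility: the price `x` itself (normal case)
or its logarithm (log-normal case). -/
def VolKind.scale : VolKind → ℝ → ℝ
  | .normal, x => x
  | .logNormal, x => Real.log x

/-- The value-at-risk at level `α`, the smallest amount of cash `m` that makes the probability of
a negative position at most `α`: `inf {m | P(Z + m < 0) ≤ α}`. -/
def valueAtRisk {Ω : Type*} [MeasurableSpace Ω] (P : Measure Ω) (α : ℝ) (Z : Ω → ℝ) : ℝ :=
  sInf {m : ℝ | P.real {ω | Z ω + m < 0} ≤ α}

/-- The quantile function `F⁻¹(p) = inf {y | p ≤ F(y)}` of the random variable `Z`. -/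
def quantile {Ω : Type*} [MeasurableSpace Ω] (P : Measure Ω) (Z : Ω → ℝ) (p : ℝ) : ℝ :=
  sInf {y : ℝ | p ≤ cdf (P.map Z) y}

/-- The volatility `max_i Var[X_i]^{1/2}` (normal) or `max_i Var[log X_i]^{1/2}` (log-normal). -/
def volatility {Ω : Type*} [MeasurableSpace Ω] {n : ℕ} (κ : VolKind) (P : Measure Ω)
    (X : Ω → Fin n → ℝ) : ℝ :=
  ⨆ i : Fin n, √(Var[fun ω => κ.scale (X ω i); P])

/-- The centred assets (normal case), or log-assets (log-normal case), divided by the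
volatility. -/
def normalized {Ω : Type*} [MeasurableSpace Ω] {n : ℕ} (κ : VolKind) (P : Measure Ω)
    (X : Ω → Fin n → ℝ) (ω : Ω) (i : Fin n) : ℝ :=
  (κ.scale (X ω i) - ∫ ω', κ.scale (X ω' i) ∂P) / volatility κ P X

/-- The version of the assets `X` with volatility `σ`, with `Y` the normalized version of `X`:
`1 + σ Y_i` in the normal case, `exp (σ Y_i) / E[exp (σ Y_i)]` in the log-normal case. -/
def assetFamily {Ω : Type*} [MeasurableSpace Ω] {n : ℕ} (κ : VolKind) (P : Measure Ω)
    (X : Ω → Fin n → ℝ) (σ : ℝ) (ω : Ω) (i : Fin n) : ℝ :=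
  match κ with
  | .normal => 1 + σ * normalized .normal P X ω i
  | .logNormal => Real.exp (σ * normalized .logNormal P X ω i) /
      mgf (fun ω' => normalized .logNormal P X ω' i) P σ

/-- The covariance matrix of the assets. -/
def covMat {Ω : Type*} [MeasurableSpace Ω] {n : ℕ} (P : Measure Ω) (X : Ω → Fin n → ℝ) :
    Matrix (Fin n) (Fin n) ℝ :=
  Matrix.of fun i j => cov[fun ω => X ω i, fun ω => X ω j; P]

/-- The surplus `S(φ) = ⟨X - 1, φ⟩ - ⟨X, L⟩`. -/
def surplus {Ω : Type*} {n : ℕ} (X L : Ω → Fin n → ℝ) (φ : Fin n → ℝ) (ω : Ω) : ℝ :=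
  (X ω - 1) ⬝ᵥ φ - X ω ⬝ᵥ L ω

/-- The total claim size `⟨1, L⟩`. -/
def totalClaim {Ω : Type*} {n : ℕ} (L : Ω → Fin n → ℝ) (ω : Ω) : ℝ :=
  1 ⬝ᵥ L ω

/-- The density `f` of the total claim size, as the derivative of its distribution function. -/
def totalDensity {Ω : Type*} [MeasurableSpace Ω] {n : ℕ} (P : Measure Ω)
    (L : Ω → Fin n → ℝ) : ℝ → ℝ :=
  deriv fun y => cdf (P.map (totalClaim L)) y

/-- `K(y) = E[L 1_{⟨1, L⟩ > y}]`. -/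
def claimK {Ω : Type*} [MeasurableSpace Ω] {n : ℕ} (P : Measure Ω) (L : Ω → Fin n → ℝ)
    (y : ℝ) : Fin n → ℝ :=
  ∫ ω in {ω | y < totalClaim L ω}, L ω ∂P

/-- `K[Z](y) = E[⟨Z, Σ Z⟩ 1_{⟨1, L⟩ > y}]`, for a matrix `Σ` (here `A`) and a random
vector `Z`. -/
def quadK {Ω : Type*} [MeasurableSpace Ω] {n : ℕ} (P : Measure Ω) (L : Ω → Fin n → ℝ)
    (A : Matrix (Fin n) (Fin n) ℝ) (Z : Ω → Fin n → ℝ) (y : ℝ) : ℝ :=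
  ∫ ω in {ω | y < totalClaim L ω}, Z ω ⬝ᵥ (A *ᵥ Z ω) ∂P

/-- The second-order expansion `q + K[φ - L]''(q) / (2 f(q))` of the value-at-risk of the surplus,
when the assets have covariance matrix `A`. -/
def secondOrderVaR {Ω : Type*} [MeasurableSpace Ω] {n : ℕ} (P : Measure Ω) (L : Ω → Fin n → ℝ)
    (A : Matrix (Fin n) (Fin n) ℝ) (q : ℝ) (φ : Fin n → ℝ) : ℝ :=
  q + 1 / 2 * (totalDensity P L q)⁻¹ * iteratedDeriv 2 (quadK P L A fun ω => φ - L ω) q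

/-- The standing assumptions on the assets `X` and the claim sizes `L` with joint density `fL`. -/
structure StandingAssumptions {Ω : Type*} [MeasurableSpace Ω] {n : ℕ} (P : Measure Ω)
    (X L : Ω → Fin n → ℝ) (fL : (Fin n → ℝ) → ℝ) : Prop where
  measurable_asset : Measurable X
  measurable_claim : Measurable L
  asset_pos : ∀ᵐ ω ∂P, ∀ i, 0 < X ω i
  indep : IndepFun X L P
  integrable_asset : ∀ i, Integrable (fun ω => X ω i) P
  integrable_asset_inv : ∀ i, Integrable (fun ω => (X ω i)⁻¹) P
  integrable_claim : ∀ i, Integrable (fun ω => L ω i) P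
  integrable_liability : Integrable (fun ω => X ω ⬝ᵥ L ω) P
  asset_mean : ∀ i, ∫ ω, X ω i ∂P = 1
  claim_mean : ∀ i, ∫ ω, L ω i ∂P = 0
  claim_density : P.map L = volume.withDensity fun ℓ => ENNReal.ofReal (fL ℓ)
  density_pos : ∀ ℓ, 0 < fL ℓ
  density_bounded : ∃ C, ∀ ℓ, fL ℓ ≤ C

/-- Smoothness of the joint density of the claim sizes: it is twice continuously differentiable,
and it and its derivatives up to order two are integrable against the weight `1 + ‖ℓ‖²`. -/
structure RegularDensity {n : ℕ} (fL : (Fin n → ℝ) → ℝ) : Prop where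
  contDiff : ContDiff ℝ 2 fL
  integrable_deriv : ∀ k : ℕ, k ≤ 2 →
    Integrable (fun ℓ => (1 + ‖ℓ‖ ^ 2) * ‖iteratedFDeriv ℝ k fL ℓ‖) volume

end

end SurplusRisk

/-! Write w = X_σ - 1. A loss S_σ(φ) + m < 0 occurs exactly when L lies in the half-space m < ⟨1, L⟩
+ ⟨w, L - φ⟩. As w and L are independent, its probability is the mean over w of `lossProb`, the mass
that the density of L gives to a slightly tilted half-space.

Such a mass can be expanded in w without surface integrals. By `hasDerivAt_setIntegral_halfSpace`,
the derivative in t of the integral of p over {ℓ₀ + t ℓ₁ > 0} is, up to an explicit factor, the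
integral over the same half-space of the derivative of ℓ₁ p in a fixed direction e transversal to
the boundary. Used twice, this gives the expansion T(m) - Σ w_i T_i'(m) + ½ Σ w_i w_j T_ij''(m),
where T, T_i, T_ij are the tail integrals of f_L and of its first and second moment densities about
φ. The remainder is o(‖w‖²) uniformly for levels m near q (`RegularDensity.exists_abs_lossRem_le`)
and at most C ‖w‖² for all w (`RegularDensity.exists_abs_lossRem_le_const_mul`).

Now average over w. The linear term vanishes because E[w] = 0, the quadratic one becomes ½ K[φ -
L]''(m) because E[w_i w_j] = Σ_ij, and ‖w‖ ≤ σ Z with a fixed Z in L²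
(`StandingAssumptions.exists_assetBound`). By dominated convergence the averaged remainder is o(σ²),
jointly in σ ↓ 0 and m → q (`StandingAssumptions.tendsto_integral_lossRem`).

The value-at-risk is the generalized inverse in m of this probability. The tail T has slope -f(q) <
0 at q (`StandingAssumptions.totalDensity_pos`), so the perturbation ½ K'' moves the level by K''/(2
f(q)) (`isLittleO_sInf_sub`). Expanding the second moments about φ turns the result into a quadratic
polynomial in φ with leading form -f'(q)/(2 f(q)) ⟨φ, Σφ⟩. Part b) then follows by completing the
square with Σ positive definite. -/

namespace SurplusRisk

/-! ### Limits of integrals over half-spaces and sigmoid smoothing -/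

section Indicator

variable {E : Type*} [MeasurableSpace E] {μ : Measure E}

/-- The integral over `{ℓ > 0}` depends continuously on `ℓ` at functions with null zero set. -/
theorem tendsto_setIntegral_pos {ι : Type*} {l : Filter ι} [l.IsCountablyGenerated]
    {ℓ : ι → E → ℝ} {ℓ₀ : E → ℝ} (hm : ∀ i, Measurable (ℓ i)) (hm₀ : Measurable ℓ₀)
    (hlim : ∀ u, Tendsto (fun i => ℓ i u) l (𝓝 (ℓ₀ u))) (h0 : μ {u | ℓ₀ u = 0} = 0)
    {r : E → ℝ} (hr : Integrable r μ) :
    Tendsto (fun i => ∫ u in {u | 0 < ℓ i u}, r u ∂μ) l (𝓝 (∫ u in {u | 0 < ℓ₀ u}, r u ∂μ)) := by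
  have hs : ∀ i, MeasurableSet {u | 0 < ℓ i u} := fun i => measurableSet_lt measurable_const (hm i)
  simp_rw [← fun i => integral_indicator (f := r) (μ := μ) (hs i)]
  rw [← integral_indicator (measurableSet_lt measurable_const hm₀)]
  refine tendsto_integral_filter_of_dominated_convergence (fun u => ‖r u‖)
    (.of_forall fun i => (hr.indicator (hs i)).aestronglyMeasurable)
    (.of_forall fun i => .of_forall fun u => norm_indicator_le_norm_self _ _) hr.norm ?_
  have : ∀ᵐ u ∂μ, ℓ₀ u ≠ 0 := by simpa [ae_iff] using h0
  filter_upwards [this] with u hu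
  -- Where `ℓ₀` is nonzero its sign is eventually shared by `ℓ i`, so the indicators are eventually
  -- constant.
  refine tendsto_nhds_of_eventually_eq ?_
  rcases lt_or_gt_of_ne hu with h | h
  · filter_upwards [(hlim u).eventually (gt_mem_nhds h)] with i hi
    rw [Set.indicator_of_notMem (by simp [hi.le]), Set.indicator_of_notMem (by simp [h.le])]
  · filter_upwards [(hlim u).eventually (lt_mem_nhds h)] with i hi
    rw [Set.indicator_of_mem (by exact hi), Set.indicator_of_mem (by exact h)]

/-- Smoothing the indicator function of a half-space with sigmoids. -/
theorem tendsto_integral_sigmoid {ℓ : E → ℝ} (hm : Measurable ℓ) (h0 : μ {u | ℓ u = 0} = 0)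
    {r : E → ℝ} (hr : Integrable r μ) :
    Tendsto (fun k : ℕ => ∫ u, Real.sigmoid (k * ℓ u) * r u ∂μ) atTop
      (𝓝 (∫ u in {u | 0 < ℓ u}, r u ∂μ)) := by
  rw [← integral_indicator (measurableSet_lt measurable_const hm)]
  refine tendsto_integral_filter_of_dominated_convergence (fun u => ‖r u‖)
    (.of_forall fun k => ((continuous_sigmoid.measurable.comp
      (measurable_const.mul hm)).aestronglyMeasurable.mul hr.aestronglyMeasurable))
    (.of_forall fun k => .of_forall fun u => ?_) hr.norm ?_
  · rw [norm_mul, Real.norm_of_nonneg (Real.sigmoid_nonneg _)]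
    exact mul_le_of_le_one_left (norm_nonneg _) (Real.sigmoid_le_one _)
  have : ∀ᵐ u ∂μ, ℓ u ≠ 0 := by simpa [ae_iff] using h0
  filter_upwards [this] with u hu
  rcases lt_or_gt_of_ne hu with h | h
  · rw [Set.indicator_of_notMem (by simp [h.le])]
    have := (Real.tendsto_sigmoid_atBot.comp
      (tendsto_natCast_atTop_atTop.atTop_mul_const_of_neg h)).mul_const (r u)
    simpa using this
  · rw [Set.indicator_of_mem (by exact h)]
    have := (Real.tendsto_sigmoid_atTop.comp
      (tendsto_natCast_atTop_atTop.atTop_mul_const h)).mul_const (r u)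
    simpa using this

end Indicator

/-! ### Differentiation of integrals over moving half-spaces -/

section HalfSpace

variable {E : Type*} [NormedAddCommGroup E] [NormedSpace ℝ E] [FiniteDimensional ℝ E]
  [MeasurableSpace E] [BorelSpace E] {μ : Measure E} [μ.IsAddHaarMeasure]

/-- The derivative of `p` in the direction `e`. -/
noncomputable def dirDeriv (e : E) (p : E → ℝ) (u : E) : ℝ := fderiv ℝ p u e

theorem measure_affine_eq_zero (a : E →L[ℝ] ℝ) (c : ℝ) {e : E} (he : a e ≠ 0) :
    μ {u | a u + c = 0} = 0 := by
  let s : AffineSubspace ℝ E :=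
    { carrier := {u | a u + c = 0}
      smul_vsub_vadd_mem' := by
        intro t p₁ p₂ p₃ h₁ h₂ h₃
        simp only [Set.mem_ofPred_eq, vsub_eq_sub, vadd_eq_add, map_add, map_smul, map_sub,
          smul_eq_mul] at *
        linear_combination t * h₁ - t * h₂ + h₃ }
  -- A proper affine subspace is null; if this one were everything, it would contain 0 and `e`,
  -- forcing `a e = 0`.
  refine Measure.addHaar_affineSubspace μ s fun h => he ?_
  have h0 : (0 : E) ∈ s := h ▸ AffineSubspace.mem_top ℝ E 0
  have h1 : e ∈ s := h ▸ AffineSubspace.mem_top ℝ E e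
  have h0' : a 0 + c = 0 := h0
  have h1' : a e + c = 0 := h1
  rw [map_zero] at h0'
  linarith

variable {a₀ a₁ : E →L[ℝ] ℝ} {c₀ c₁ : ℝ} {p : E → ℝ} {e : E}

/-- Differentiating in `s` and differentiating in the direction `e` both bring out the derivative of
the sigmoid, with factors `k * (a₁ u + c₁)` and `k * (a₀ e + t * a₁ e)`. Integration by parts in the
direction `e` therefore trades one for the other and leaves an expression in which `k` appears only
inside the sigmoid, ready for `k → ∞`. -/
theorem hasDerivAt_integral_sigmoid (k : ℝ) (hd : Differentiable ℝ p) (hp : Integrable p μ)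
    (h1 : Integrable (fun u => (a₁ u + c₁) * p u) μ)
    (h2 : Integrable (dirDeriv e fun u => (a₁ u + c₁) * p u) μ) {t : ℝ}
    (ht : a₀ e + t * a₁ e ≠ 0) :
    HasDerivAt (fun s => ∫ u, Real.sigmoid (k * (a₀ u + c₀ + s * (a₁ u + c₁))) * p u ∂μ)
      (-(a₀ e + t * a₁ e)⁻¹ * ∫ u, Real.sigmoid (k * (a₀ u + c₀ + t * (a₁ u + c₁))) *
        dirDeriv e (fun u => (a₁ u + c₁) * p u) u ∂μ) t := by
  set g : ℝ → E → ℝ := fun s u => k * (a₀ u + c₀ + s * (a₁ u + c₁)) with hg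
  have hgc : ∀ s, Continuous (g s) := fun s => by fun_prop
  have hgF : ∀ s u, HasFDerivAt (g s) (k • (a₀ + s • a₁)) u := fun s u => by
    have := ((((a₀ : E →L[ℝ] ℝ).hasFDerivAt (x := u)).add_const c₀).add
      (((a₁.hasFDerivAt (x := u)).add_const c₁).const_mul s)).const_mul k
    exact this
  have hσ : ∀ x, |Real.sigmoid x * (1 - Real.sigmoid x)| ≤ 1 := fun x => by
    have h0 := Real.sigmoid_nonneg x
    have h1 := Real.sigmoid_le_one x
    rw [abs_of_nonneg (mul_nonneg h0 (by linarith))]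
    nlinarith
  have hσc := continuous_sigmoid
  have key := (hasDerivAt_integral_of_dominated_loc_of_deriv_le (μ := μ)
    (F := fun s u => Real.sigmoid (g s u) * p u) (x₀ := t) (s := Set.univ)
    (F' := fun s u => Real.sigmoid (g s u) * (1 - Real.sigmoid (g s u)) * (k * (a₁ u + c₁)) * p u)
    (bound := fun u => |k| * ‖(a₁ u + c₁) * p u‖) univ_mem
    (.of_forall fun s => ((hσc.comp (hgc s)).aestronglyMeasurable.mul hp.aestronglyMeasurable))
    (hp.bdd_mul (c := 1) (hσc.comp (hgc t)).aestronglyMeasurable (.of_forall fun u => by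
      rw [Real.norm_of_nonneg (Real.sigmoid_nonneg _)]; exact Real.sigmoid_le_one _))
    ?_ ?_ (h1.norm.const_mul _) ?_).2
  · refine key.congr_deriv ?_
    have ibp := integral_mul_fderiv_eq_neg_fderiv_mul_of_integrable (μ := μ)
      (f := fun u => Real.sigmoid (g t u)) (g := fun u => (a₁ u + c₁) * p u) (v := e)
    have hf' : ∀ u, fderiv ℝ (fun u => Real.sigmoid (g t u)) u e =
        Real.sigmoid (g t u) * (1 - Real.sigmoid (g t u)) * (k * (a₀ e + t * a₁ e)) := fun u => by
      have := ((Real.hasDerivAt_sigmoid (g t u)).comp_hasFDerivAt u (hgF t u)).fderiv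
      change fderiv ℝ (Real.sigmoid ∘ g t) u e = _
      rw [this]
      simp
      ring
    have hbd : ∀ {r : E → ℝ}, Integrable r μ →
        Integrable (fun u => Real.sigmoid (g t u) * r u) μ := fun hr =>
      hr.bdd_mul (c := 1) (hσc.comp (hgc t)).aestronglyMeasurable (.of_forall fun u => by
        rw [Real.norm_of_nonneg (Real.sigmoid_nonneg _)]; exact Real.sigmoid_le_one _)
    have hbd' : Integrable (fun u => Real.sigmoid (g t u) * (1 - Real.sigmoid (g t u)) *
        (k * (a₀ e + t * a₁ e)) * ((a₁ u + c₁) * p u)) μ := by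
      have : Integrable (fun u => Real.sigmoid (g t u) * (1 - Real.sigmoid (g t u)) *
        ((a₁ u + c₁) * p u)) μ :=
        h1.bdd_mul (c := 1) ((hσc.comp (hgc t)).mul
          (continuous_const.sub (hσc.comp (hgc t)))).aestronglyMeasurable
          (.of_forall fun u => hσ _)
      refine (this.const_mul (k * (a₀ e + t * a₁ e))).congr (.of_forall fun u => ?_)
      simp only; ring
    simp only [hf'] at ibp
    have ibp' := ibp hbd' (hbd h2) (hbd h1)
      (fun u _ => ((Real.hasDerivAt_sigmoid (g t u)).comp_hasFDerivAt u (hgF t u)).differentiableAt)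
      (fun u _ => ((a₁.differentiableAt.add_const _).mul (hd u)))
    have e1 : ∫ u, Real.sigmoid (g t u) * dirDeriv e (fun u => (a₁ u + c₁) * p u) u ∂μ =
      -((a₀ e + t * a₁ e) * ∫ u, Real.sigmoid (g t u) * (1 - Real.sigmoid (g t u)) *
        (k * (a₁ u + c₁)) * p u ∂μ) := by
      rw [← integral_const_mul]
      refine ibp'.trans (congrArg _ (integral_congr_ae (.of_forall fun u => ?_)))
      simp only; ring
    change _ = -(a₀ e + t * a₁ e)⁻¹ * ∫ u, Real.sigmoid (g t u) * dirDeriv e (fun u => (a₁ u + c₁) * p u) u ∂μ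
    rw [e1, neg_mul_neg, inv_mul_cancel_left₀ ht]
  · have hpm := hp.aestronglyMeasurable
    refine AEStronglyMeasurable.mul (Continuous.aestronglyMeasurable ?_) hpm
    exact ((hσc.comp (hgc t)).mul (continuous_const.sub (hσc.comp (hgc t)))).mul (by fun_prop)
  · refine .of_forall fun u s _ => ?_
    rw [show Real.sigmoid (g s u) * (1 - Real.sigmoid (g s u)) * (k * (a₁ u + c₁)) * p u =
      (Real.sigmoid (g s u) * (1 - Real.sigmoid (g s u))) * (k * ((a₁ u + c₁) * p u)) by ring,
      norm_mul, norm_mul k, Real.norm_eq_abs k]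
    exact mul_le_of_le_one_left (by positivity) (hσ _)
  · refine .of_forall fun u s _ => ?_
    have hgs : HasDerivAt (fun s => g s u) (k * (a₁ u + c₁)) s := by
      simpa using (((hasDerivAt_id s).mul_const (a₁ u + c₁)).const_add (a₀ u + c₀)).const_mul k
    exact ((Real.hasDerivAt_sigmoid (g s u)).comp s hgs).mul_const (p u)

/-- Differentiating the integral of `p` over a moving half-space `{ℓ₀ + t ℓ₁ > 0}`. -/
theorem hasDerivAt_setIntegral_halfSpace (hd : Differentiable ℝ p) (hp : Integrable p μ)
    (h1 : Integrable (fun u => (a₁ u + c₁) * p u) μ)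
    (h2 : Integrable (dirDeriv e fun u => (a₁ u + c₁) * p u) μ) {t : ℝ}
    (ht : a₀ e + t * a₁ e ≠ 0) :
    HasDerivAt (fun s => ∫ u in {u | 0 < a₀ u + c₀ + s * (a₁ u + c₁)}, p u ∂μ)
      (-(a₀ e + t * a₁ e)⁻¹ * ∫ u in {u | 0 < a₀ u + c₀ + t * (a₁ u + c₁)},
        dirDeriv e (fun u => (a₁ u + c₁) * p u) u ∂μ) t := by
  set D := dirDeriv e fun u => (a₁ u + c₁) * p u with hD
  have hnull : ∀ s, a₀ e + s * a₁ e ≠ 0 → μ {u | a₀ u + c₀ + s * (a₁ u + c₁) = 0} = 0 := by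
    intro s hs
    convert measure_affine_eq_zero (μ := μ) (a₀ + s • a₁) (c₀ + s * c₁) (e := e) (by simpa) using 3
    simp only [_root_.add_apply, _root_.smul_apply, smul_eq_mul]
    funext u
    congr 1
    ring
  have hmeas : ∀ s, Measurable fun u => a₀ u + c₀ + s * (a₁ u + c₁) := fun s =>
    (show Continuous fun u => a₀ u + c₀ + s * (a₁ u + c₁) by fun_prop).measurable
  obtain ⟨ε, hε, hball⟩ : ∃ ε > 0, ∀ s, |s - t| < ε → a₀ e + s * a₁ e ≠ 0 := by
    have : ∀ᶠ s in 𝓝 t, a₀ e + s * a₁ e ≠ 0 :=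
      (show Continuous fun s => a₀ e + s * a₁ e by fun_prop).continuousAt.eventually_ne ht
    exact Metric.eventually_nhds_iff.1 this
  set c : ℝ → ℝ := fun s => -(a₀ e + s * a₁ e)⁻¹ *
    ∫ u in {u | 0 < a₀ u + c₀ + s * (a₁ u + c₁)}, D u ∂μ with hc
  have hcont : ∀ s, |s - t| < ε → ContinuousAt c s := fun s hs => by
    refine ContinuousAt.mul ?_ ?_
    · exact ((show Continuous fun s => a₀ e + s * a₁ e by fun_prop).continuousAt.inv₀
        (hball s hs)).neg
    · exact tendsto_setIntegral_pos hmeas (hmeas s)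
        (fun u => (show Continuous fun s => a₀ u + c₀ + s * (a₁ u + c₁) by fun_prop).tendsto s)
        (hnull s (hball s hs)) h2
  have hIcc : ∀ s, |s - t| < ε → ∀ x ∈ Set.uIcc t s, |x - t| < ε := fun s hs x hx =>
    (Set.abs_sub_left_of_mem_uIcc hx).trans_lt hs
  have hfi : ∀ s, |s - t| < ε → IntervalIntegrable c volume t s := fun s hs =>
    ContinuousOn.intervalIntegrable fun x hx => (hcont x (hIcc s hs x hx)).continuousWithinAt
  -- The limit `k → ∞` is taken in the integrated identity, where dominated convergence suffices;
  -- convergence of derivatives would need uniformity. Continuity of `c` then recovers the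
  -- derivative at `t`.
  have hid : ∀ s, |s - t| < ε →
      (∫ u in {u | 0 < a₀ u + c₀ + s * (a₁ u + c₁)}, p u ∂μ) =
      (∫ u in {u | 0 < a₀ u + c₀ + t * (a₁ u + c₁)}, p u ∂μ) + ∫ x in t..s, c x := by
    intro s hs
    set F : ℕ → ℝ → ℝ := fun k s =>
      ∫ u, Real.sigmoid (k * (a₀ u + c₀ + s * (a₁ u + c₁))) * p u ∂μ with hF
    set F' : ℕ → ℝ → ℝ := fun k s => -(a₀ e + s * a₁ e)⁻¹ *
      ∫ u, Real.sigmoid (k * (a₀ u + c₀ + s * (a₁ u + c₁))) * D u ∂μ with hF'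
    have hF'cont : ∀ k x, |x - t| < ε → ContinuousAt (F' k) x := fun k x hx => by
      refine ContinuousAt.mul ?_ ?_
      · exact ((show Continuous fun s => a₀ e + s * a₁ e by fun_prop).continuousAt.inv₀
          (hball x hx)).neg
      · refine Continuous.continuousAt (continuous_of_dominated
          (fun s => ?_) (bound := fun u => ‖D u‖) (fun s => .of_forall fun u => ?_) h2.norm
          (.of_forall fun u => ?_))
        · exact ((continuous_sigmoid.measurable.comp
            (measurable_const.mul (hmeas s))).aestronglyMeasurable.mul h2.aestronglyMeasurable)
        · rw [norm_mul, Real.norm_of_nonneg (Real.sigmoid_nonneg _)]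
          exact mul_le_of_le_one_left (norm_nonneg _) (Real.sigmoid_le_one _)
        · exact (continuous_sigmoid.comp (by fun_prop)).mul continuous_const
    have hFTC : ∀ k, F k s = F k t + ∫ x in t..s, F' k x := fun k => by
      rw [intervalIntegral.integral_eq_sub_of_hasDerivAt
        (fun x hx => hasDerivAt_integral_sigmoid k hd hp h1 h2 (hball x (hIcc s hs x hx)))
        (ContinuousOn.intervalIntegrable fun x hx =>
          (hF'cont k x (hIcc s hs x hx)).continuousWithinAt)]
      ring
    have hL := tendsto_integral_sigmoid (μ := μ) (hmeas s) (hnull s (hball s hs)) hp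
    have hR := tendsto_integral_sigmoid (μ := μ) (hmeas t) (hnull t ht) hp
    have hI : Tendsto (fun k => ∫ x in t..s, F' k x) atTop (𝓝 (∫ x in t..s, c x)) := by
      refine intervalIntegral.tendsto_integral_filter_of_dominated_convergence
        (fun x => |(a₀ e + x * a₁ e)⁻¹| * ∫ u, ‖D u‖ ∂μ) (.of_forall fun k => ?_)
        (.of_forall fun k => .of_forall fun x _ => ?_) ?_ (.of_forall fun x hx => ?_)
      · exact (intervalIntegrable_iff.1 (ContinuousOn.intervalIntegrable fun x hx =>
          (hF'cont k x (hIcc s hs x hx)).continuousWithinAt)).aestronglyMeasurable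
      · rw [norm_mul, norm_neg, Real.norm_eq_abs]
        gcongr
        refine norm_integral_le_of_norm_le h2.norm (.of_forall fun u => ?_)
        rw [norm_mul, Real.norm_of_nonneg (Real.sigmoid_nonneg _)]
        exact mul_le_of_le_one_left (norm_nonneg _) (Real.sigmoid_le_one _)
      · refine ContinuousOn.intervalIntegrable fun x hx => ContinuousAt.continuousWithinAt ?_
        exact (((show Continuous fun s => a₀ e + s * a₁ e by fun_prop).continuousAt.inv₀
          (hball x (hIcc s hs x hx))).abs).mul continuousAt_const
      · exact (tendsto_integral_sigmoid (hmeas x)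
          (hnull x (hball x (hIcc s hs x (Set.uIoc_subset_uIcc hx)))) h2).const_mul _
    have hL' : Tendsto (fun k => F k s) atTop _ := hL
    rw [show (fun k => F k s) = fun k => F k t + ∫ x in t..s, F' k x from funext hFTC] at hL'
    exact tendsto_nhds_unique hL' (hR.add hI)
  have hmain : HasDerivAt (fun s => (∫ u in {u | 0 < a₀ u + c₀ + t * (a₁ u + c₁)}, p u ∂μ) +
      ∫ x in t..s, c x) (c t) t := by
    refine (intervalIntegral.integral_hasDerivAt_right (by simp) ?_ (hcont t (by simpa))).const_add _
    refine ContinuousOn.stronglyMeasurableAtFilter (s := Metric.ball t ε) Metric.isOpen_ball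
      (fun x hx => (hcont x (by simpa [Real.dist_eq] using hx)).continuousWithinAt) t
      (Metric.mem_ball_self hε)
  refine hmain.congr_of_eventuallyEq ?_
  filter_upwards [Metric.ball_mem_nhds t hε] with s hs
  exact hid s (by simpa [Real.dist_eq] using hs)

end HalfSpace

/-! ### A second-order Taylor estimate -/

section Calculus

/-- Second-order Taylor formula on `[0, 1]`, the error bounded by the oscillation of the second
derivative. -/
theorem abs_taylor_two_le {k k₁ k₂ : ℝ → ℝ} {B : ℝ}
    (h1 : ∀ t ∈ Set.Icc (0 : ℝ) 1, HasDerivAt k (k₁ t) t)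
    (h2 : ∀ t ∈ Set.Icc (0 : ℝ) 1, HasDerivAt k₁ (k₂ t) t)
    (hB : ∀ t ∈ Set.Icc (0 : ℝ) 1, |k₂ t - k₂ 0| ≤ B) :
    |k 1 - k 0 - k₁ 0 - 1 / 2 * k₂ 0| ≤ B := by
  have hB0 : 0 ≤ B := (abs_nonneg _).trans (hB 0 (by simp))
  have hg1 : ∀ t ∈ Set.Icc (0 : ℝ) 1, |k₁ t - k₁ 0 - t * k₂ 0| ≤ B := by
    intro t ht
    have := norm_image_sub_le_of_norm_deriv_le_segment' (f := fun t => k₁ t - t * k₂ 0)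
      (f' := fun t => k₂ t - k₂ 0) (C := B) (a := 0) (b := 1) (fun x hx => by
        have hl : HasDerivAt (fun t : ℝ => t * k₂ 0) (k₂ 0) x := by
          simpa using (hasDerivAt_id x).mul_const (k₂ 0)
        exact ((h2 x hx).sub hl).hasDerivWithinAt)
      (fun x hx => hB x (Set.Ico_subset_Icc_self hx)) t ht
    simp only [Real.norm_eq_abs, zero_mul, sub_zero] at this
    rw [show k₁ t - k₁ 0 - t * k₂ 0 = k₁ t - t * k₂ 0 - k₁ 0 by ring]
    exact this.trans (mul_le_of_le_one_right hB0 ht.2)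
  have := norm_image_sub_le_of_norm_deriv_le_segment'
    (f := fun t => k t - t * k₁ 0 - t ^ 2 / 2 * k₂ 0)
    (f' := fun t => k₁ t - k₁ 0 - t * k₂ 0) (C := B) (a := 0) (b := 1) (fun x hx => by
      have hq : HasDerivAt (fun t : ℝ => t ^ 2 / 2) x x := by
        simpa using ((hasDerivAt_id x).pow 2).div_const 2
      have hl : HasDerivAt (fun t : ℝ => t * k₁ 0) (k₁ 0) x := by
        simpa using (hasDerivAt_id x).mul_const (k₁ 0)
      exact (((h1 x hx).sub hl).sub (hq.mul_const (k₂ 0))).hasDerivWithinAt)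
    (fun x hx => hg1 x (Set.Ico_subset_Icc_self hx)) 1 (by simp)
  simp only [Real.norm_eq_abs] at this
  convert this using 2 <;> ring

theorem abs_setIntegral_le {E : Type*} [MeasurableSpace E] {μ : Measure E} {p : E → ℝ}
    (s : Set E) (hp : Integrable p μ) :
    |∫ u in s, p u ∂μ| ≤ ∫ u, ‖p u‖ ∂μ :=
  (norm_integral_le_integral_norm _).trans
    (setIntegral_le_integral hp.norm (.of_forall fun _ => norm_nonneg _))

end Calculus

/-! ### Densities with polynomial weights -/

section Class

variable {E : Type*} [NormedAddCommGroup E] [NormedSpace ℝ E]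

/-- `Q` is `C²`, and `Q` and its derivatives up to order two grow at most like `‖u‖ ^ d`. -/
structure PolyGrowth (d : ℕ) (Q : E → ℝ) : Prop where
  contDiff : ContDiff ℝ 2 Q
  bound : ∃ C, 0 ≤ C ∧ ∀ k ≤ 2, ∀ u, ‖iteratedFDeriv ℝ k Q u‖ ≤ C * (1 + ‖u‖) ^ d

theorem PolyGrowth.mono {d d' : ℕ} {Q : E → ℝ} (h : PolyGrowth d Q) (hd : d ≤ d') :
    PolyGrowth d' Q := by
  obtain ⟨C, hC, hb⟩ := h.bound
  refine ⟨h.contDiff, C, hC, fun k hk u => (hb k hk u).trans ?_⟩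
  gcongr
  linarith [norm_nonneg u]

theorem PolyGrowth.const (c : ℝ) : PolyGrowth 0 (fun _ : E => c) := by
  refine ⟨contDiff_const, |c|, abs_nonneg c, fun k _ u => ?_⟩
  rcases eq_or_ne k 0 with rfl | hk
  · simp
  · simp [iteratedFDeriv_const_of_ne hk]

theorem PolyGrowth.affine (a : E →L[ℝ] ℝ) (c : ℝ) : PolyGrowth 1 (fun u => a u + c) := by
  refine ⟨by fun_prop, ‖a‖ + |c|, by positivity, fun k _ u => ?_⟩
  have hu := norm_nonneg u
  have ha := norm_nonneg a
  have hc := abs_nonneg c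
  have hau : |a u + c| ≤ ‖a‖ * ‖u‖ + |c| :=
    (abs_add_le _ _).trans (by gcongr; exact a.le_opNorm u)
  rcases k with _ | k
  · rw [norm_iteratedFDeriv_zero, Real.norm_eq_abs]
    nlinarith
  · rw [← norm_iteratedFDeriv_fderiv]
    have : fderiv ℝ (fun u => a u + c) = fun _ => a := by
      funext u
      exact (a.hasFDerivAt.add_const c).fderiv
    rw [this]
    rcases eq_or_ne k 0 with rfl | hk
    · rw [norm_iteratedFDeriv_zero]; nlinarith
    · rw [iteratedFDeriv_const_of_ne hk]; simp; positivity

theorem PolyGrowth.mul {d d' : ℕ} {Q R : E → ℝ} (hQ : PolyGrowth d Q) (hR : PolyGrowth d' R) :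
    PolyGrowth (d + d') (fun u => Q u * R u) := by
  obtain ⟨C, hC, hb⟩ := hQ.bound
  obtain ⟨C', hC', hb'⟩ := hR.bound
  refine ⟨hQ.contDiff.mul hR.contDiff, 4 * (C * C'), by positivity, fun k hk u => ?_⟩
  refine (norm_iteratedFDeriv_mul_le hQ.contDiff hR.contDiff u (n := k)
    (by exact_mod_cast hk)).trans ?_
  calc ∑ i ∈ Finset.range (k + 1), (k.choose i : ℝ) * ‖iteratedFDeriv ℝ i Q u‖ *
        ‖iteratedFDeriv ℝ (k - i) R u‖
      ≤ ∑ i ∈ Finset.range (k + 1), (k.choose i : ℝ) * ((C * (1 + ‖u‖) ^ d) *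
        (C' * (1 + ‖u‖) ^ d')) := by
        refine Finset.sum_le_sum fun i hi => ?_
        rw [mul_assoc]
        have hi' := Finset.mem_range.1 hi
        gcongr
        · exact hb i (by omega) u
        · exact hb' (k - i) (by omega) u
    _ = 2 ^ k * (C * C' * (1 + ‖u‖) ^ (d + d')) := by
        rw [← Finset.sum_mul]
        have : ∑ i ∈ Finset.range (k + 1), (k.choose i : ℝ) = 2 ^ k := by
          exact_mod_cast Nat.sum_range_choose k
        rw [this, pow_add]
        ring
    _ ≤ 2 ^ 2 * (C * C' * (1 + ‖u‖) ^ (d + d')) := by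
        gcongr
        · norm_num
    _ = _ := by ring

variable [MeasurableSpace E] {μ : Measure E}

/-- `p` is `C²` and integrable with its derivatives up to order two. -/
structure IntegrableC2 (μ : Measure E) (p : E → ℝ) : Prop where
  contDiff : ContDiff ℝ 2 p
  integrable_iteratedFDeriv : ∀ k ≤ 2, Integrable (fun u => ‖iteratedFDeriv ℝ k p u‖) μ

/-- Leibniz' rule, with `(1 + ‖u‖) ^ 2 ≤ 2 * (1 + ‖u‖ ^ 2)`. Degree two is what second moments of
the claims require, and it matches the weight in `RegularDensity`. -/
theorem PolyGrowth.integrableC2_mul [BorelSpace E] [SecondCountableTopology E] {Q f : E → ℝ}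
    (hQ : PolyGrowth 2 Q) (hf : ContDiff ℝ 2 f)
    (hfi : ∀ k : ℕ, k ≤ 2 →
      Integrable (fun u => (1 + ‖u‖ ^ 2) * ‖iteratedFDeriv ℝ k f u‖) μ) :
    IntegrableC2 μ (fun u => Q u * f u) := by
  obtain ⟨C, hC, hb⟩ := hQ.bound
  refine ⟨hQ.contDiff.mul hf, fun k hk => ?_⟩
  have hcont : Continuous fun u => ‖iteratedFDeriv ℝ k (fun u => Q u * f u) u‖ :=
    ((hQ.contDiff.mul hf).continuous_iteratedFDeriv (m := k) (by exact_mod_cast hk)).norm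
  refine Integrable.mono' (g := fun u => ∑ i ∈ Finset.range (k + 1), (k.choose i : ℝ) * (2 * C) *
    ((1 + ‖u‖ ^ 2) * ‖iteratedFDeriv ℝ (k - i) f u‖))
    (integrable_finsetSum _ fun i _ => (hfi (k - i) (by omega)).const_mul _)
    hcont.aestronglyMeasurable (.of_forall fun u => ?_)
  rw [norm_norm]
  refine (norm_iteratedFDeriv_mul_le hQ.contDiff hf u (n := k) (by exact_mod_cast hk)).trans ?_
  refine Finset.sum_le_sum fun i hi => ?_
  have hi' := Finset.mem_range.1 hi
  have h2 : (1 + ‖u‖) ^ 2 ≤ 2 * (1 + ‖u‖ ^ 2) := by nlinarith [sq_nonneg (1 - ‖u‖)]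
  calc (k.choose i : ℝ) * ‖iteratedFDeriv ℝ i Q u‖ * ‖iteratedFDeriv ℝ (k - i) f u‖
      ≤ (k.choose i : ℝ) * (C * (2 * (1 + ‖u‖ ^ 2))) * ‖iteratedFDeriv ℝ (k - i) f u‖ := by
        gcongr
        exact (hb i (by omega) u).trans (by gcongr)
    _ = _ := by ring

variable {p : E → ℝ}

theorem IntegrableC2.differentiable (h : IntegrableC2 μ p) : Differentiable ℝ p :=
  h.contDiff.differentiable (by norm_num)

theorem IntegrableC2.contDiff_dirDeriv (h : IntegrableC2 μ p) (e : E) :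
    ContDiff ℝ 1 (dirDeriv e p) :=
  (h.contDiff.fderiv_right (m := 1) (by norm_num)).clm_apply contDiff_const

theorem IntegrableC2.differentiable_dirDeriv (h : IntegrableC2 μ p) (e : E) :
    Differentiable ℝ (dirDeriv e p) :=
  (h.contDiff_dirDeriv e).differentiable (by norm_num)

variable [BorelSpace E]

theorem IntegrableC2.integrable (h : IntegrableC2 μ p) : Integrable p μ := by
  refine (integrable_norm_iff h.contDiff.continuous.aestronglyMeasurable).1 ?_
  simpa using h.integrable_iteratedFDeriv 0 (by norm_num)

theorem IntegrableC2.integrable_dirDeriv (h : IntegrableC2 μ p) (e : E) :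
    Integrable (dirDeriv e p) μ := by
  refine ((h.integrable_iteratedFDeriv 1 (by norm_num)).mul_const ‖e‖).mono'
    (h.contDiff_dirDeriv e).continuous.aestronglyMeasurable (.of_forall fun u => ?_)
  rw [norm_iteratedFDeriv_one]
  exact (fderiv ℝ p u).le_opNorm e

theorem IntegrableC2.integrable_dirDeriv_dirDeriv (h : IntegrableC2 μ p) (e : E) :
    Integrable (dirDeriv e (dirDeriv e p)) μ := by
  refine ((h.integrable_iteratedFDeriv 2 le_rfl).mul_const (‖e‖ * ‖e‖)).mono'
    (((h.contDiff_dirDeriv e).fderiv_right (m := 0) (by norm_num)).clm_apply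
      contDiff_const).continuous.aestronglyMeasurable (.of_forall fun u => ?_)
  have hd : Differentiable ℝ (fderiv ℝ p) :=
    (h.contDiff.fderiv_right (m := 1) (by norm_num)).differentiable (by norm_num)
  have h1 : fderiv ℝ (dirDeriv e p) u e = fderiv ℝ (fderiv ℝ p) u e e := by
    have : HasFDerivAt (dirDeriv e p) _ u :=
      (hd u).hasFDerivAt.clm_apply (hasFDerivAt_const e u)
    rw [this.fderiv]
    simp
  rw [← norm_iteratedFDeriv_fderiv, norm_iteratedFDeriv_one]
  change ‖fderiv ℝ (dirDeriv e p) u e‖ ≤ _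
  rw [h1, ← mul_assoc]
  exact (ContinuousLinearMap.le_opNorm _ _).trans (by gcongr; exact ContinuousLinearMap.le_opNorm _ _)

end Class

/-! ### Tail integrals and their Taylor expansion under tilting -/

section HalfSpace

variable {E : Type*} [NormedAddCommGroup E] [NormedSpace ℝ E] [FiniteDimensional ℝ E]
  [MeasurableSpace E] [BorelSpace E] {μ : Measure E} [μ.IsAddHaarMeasure]
  {p : E → ℝ} {e : E}

/-- The integral of `p` over the half-space `{a > y}`. -/
noncomputable def halfSpaceIntegral (μ : Measure E) (a : E →L[ℝ] ℝ) (p : E → ℝ) (y : ℝ) : ℝ :=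
  ∫ u in {u | y < a u}, p u ∂μ

variable {a : E →L[ℝ] ℝ}

theorem continuous_halfSpaceIntegral (ha : a e = 1) (hp : Integrable p μ) :
    Continuous (halfSpaceIntegral μ a p) := by
  rw [continuous_iff_continuousAt]
  intro y
  have := tendsto_setIntegral_pos (μ := μ) (l := 𝓝 y) (ℓ := fun y u => a u - y)
    (ℓ₀ := fun u => a u - y) (fun y => by fun_prop) (by fun_prop)
    (fun u => (show Continuous fun y => a u - y by fun_prop).tendsto y)
    (by simpa [sub_eq_add_neg] using measure_affine_eq_zero (μ := μ) a (-y) (e := e) (by simp [ha]))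
    hp
  change Tendsto (fun y => ∫ u in {u | y < a u}, p u ∂μ) (𝓝 y) (𝓝 (∫ u in {u | y < a u}, p u ∂μ))
  simpa using this

/-- The special case `ℓ₁ = -1` of a moving half-space, a pure translation. Because `a e = 1`,
differentiating in the level amounts to differentiating the integrand along `e`. -/
theorem hasDerivAt_halfSpaceIntegral (ha : a e = 1) (hd : Differentiable ℝ p)
    (hp : Integrable p μ) (h1 : Integrable (dirDeriv e p) μ) (y : ℝ) :
    HasDerivAt (halfSpaceIntegral μ a p) (halfSpaceIntegral μ a (dirDeriv e p) y) y := by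
  have hneg : (dirDeriv e fun u => ((0 : E →L[ℝ] ℝ) u + (-1)) * p u) = fun u => -dirDeriv e p u := by
    funext u
    have : (fun u => ((0 : E →L[ℝ] ℝ) u + (-1)) * p u) = fun u => - p u := by
      funext u; simp
    rw [this]
    simp only [dirDeriv]
    rw [fderiv_fun_neg]
    simp
  have := hasDerivAt_setIntegral_halfSpace (μ := μ) (a₀ := a) (a₁ := 0) (c₀ := 0) (c₁ := -1)
    (p := p) (e := e) hd hp (by simpa using hp.neg) (by rw [hneg]; exact h1.neg) (t := y)
    (by simp [ha])
  rw [hneg] at this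
  change HasDerivAt (fun y => ∫ u in {u | y < a u}, p u ∂μ)
    (∫ u in {u | y < a u}, dirDeriv e p u ∂μ) y
  simpa [ha, integral_neg, ← sub_eq_add_neg] using this

theorem IntegrableC2.hasDerivAt_halfSpaceIntegral (h : IntegrableC2 μ p) (ha : a e = 1) (y : ℝ) :
    HasDerivAt (halfSpaceIntegral μ a p) (halfSpaceIntegral μ a (dirDeriv e p) y) y :=
  SurplusRisk.hasDerivAt_halfSpaceIntegral ha h.differentiable h.integrable
    (h.integrable_dirDeriv e) y

theorem IntegrableC2.hasDerivAt_halfSpaceIntegral_dirDeriv (h : IntegrableC2 μ p) (ha : a e = 1)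
    (y : ℝ) : HasDerivAt (halfSpaceIntegral μ a (dirDeriv e p))
      (halfSpaceIntegral μ a (dirDeriv e (dirDeriv e p)) y) y :=
  SurplusRisk.hasDerivAt_halfSpaceIntegral ha (h.differentiable_dirDeriv e)
    (h.integrable_dirDeriv e) (h.integrable_dirDeriv_dirDeriv e) y

theorem contDiff_one_of_hasDerivAt {g g' : ℝ → ℝ} (h : ∀ y, HasDerivAt g (g' y) y)
    (hc : Continuous g') : ContDiff ℝ 1 g := by
  rw [contDiff_one_iff_deriv]
  exact ⟨fun y => (h y).differentiableAt, by rwa [show deriv g = g' from funext fun y => (h y).deriv]⟩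

theorem IntegrableC2.contDiff_halfSpaceIntegral_dirDeriv (h : IntegrableC2 μ p) (ha : a e = 1) :
    ContDiff ℝ 1 (halfSpaceIntegral μ a (dirDeriv e p)) :=
  contDiff_one_of_hasDerivAt (h.hasDerivAt_halfSpaceIntegral_dirDeriv ha)
    (continuous_halfSpaceIntegral ha (h.integrable_dirDeriv_dirDeriv e))

theorem IntegrableC2.contDiff_halfSpaceIntegral (h : IntegrableC2 μ p) (ha : a e = 1) :
    ContDiff ℝ 2 (halfSpaceIntegral μ a p) := by
  rw [show (2 : WithTop ℕ∞) = 1 + 1 by norm_num, contDiff_succ_iff_deriv]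
  refine ⟨fun y => (h.hasDerivAt_halfSpaceIntegral ha y).differentiableAt, by simp, ?_⟩
  rw [funext fun y => (h.hasDerivAt_halfSpaceIntegral ha y).deriv]
  exact h.contDiff_halfSpaceIntegral_dirDeriv ha

theorem IntegrableC2.iteratedDeriv_halfSpaceIntegral (h : IntegrableC2 μ p) (ha : a e = 1) :
    iteratedDeriv 2 (halfSpaceIntegral μ a p) =
      halfSpaceIntegral μ a (dirDeriv e (dirDeriv e p)) := by
  rw [iteratedDeriv_succ, iteratedDeriv_one,
    funext fun y => (h.hasDerivAt_halfSpaceIntegral ha y).deriv]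
  exact funext fun y => (h.hasDerivAt_halfSpaceIntegral_dirDeriv ha y).deriv

variable {a₀ a₁ : E →L[ℝ] ℝ} {c₀ c₁ : ℝ} {f : E → ℝ}

/-- Second-order Taylor expansion of the integral of `f` over the half-space
`{ℓ₀ + t ℓ₁ > 0}`, at `t = 1`. -/
theorem abs_setIntegral_halfSpace_taylor_le (hf : IntegrableC2 μ f)
    (hf1 : IntegrableC2 μ fun u => (a₁ u + c₁) * f u)
    (hf2 : IntegrableC2 μ fun u => (a₁ u + c₁) * (a₁ u + c₁) * f u)
    (ha : a₀ e = 1) (hne : ∀ t ∈ Set.Icc (0 : ℝ) 1, 1 + t * a₁ e ≠ 0) {B : ℝ}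
    (hB : ∀ t ∈ Set.Icc (0 : ℝ) 1,
      |((1 + t * a₁ e)⁻¹ ^ 2 * ∫ u in {u | 0 < a₀ u + c₀ + t * (a₁ u + c₁)},
        dirDeriv e (dirDeriv e fun u => (a₁ u + c₁) * (a₁ u + c₁) * f u) u ∂μ)
      - halfSpaceIntegral μ a₀
        (dirDeriv e (dirDeriv e fun u => (a₁ u + c₁) * (a₁ u + c₁) * f u)) (-c₀)| ≤ B) :
    |(∫ u in {u | 0 < a₀ u + c₀ + (a₁ u + c₁)}, f u ∂μ) - halfSpaceIntegral μ a₀ f (-c₀)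
      + halfSpaceIntegral μ a₀ (dirDeriv e fun u => (a₁ u + c₁) * f u) (-c₀)
      - 1 / 2 * halfSpaceIntegral μ a₀
        (dirDeriv e (dirDeriv e fun u => (a₁ u + c₁) * (a₁ u + c₁) * f u)) (-c₀)| ≤ B := by
  set p₁ : E → ℝ := fun u => (a₁ u + c₁) * f u with hp₁
  set p₂ : E → ℝ := fun u => (a₁ u + c₁) * (a₁ u + c₁) * f u with hp₂
  have hl : ∀ u, HasFDerivAt (fun u => a₁ u + c₁) a₁ u := fun u => a₁.hasFDerivAt.add_const c₁
  have hDp₂ : ∀ u, dirDeriv e p₂ u = a₁ e * p₁ u + (a₁ u + c₁) * dirDeriv e p₁ u := fun u => by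
    have h2 : p₂ = fun u => (a₁ u + c₁) * p₁ u := by funext u; simp only [hp₁, hp₂]; ring
    have h3 : HasFDerivAt p₂ ((a₁ u + c₁) • fderiv ℝ p₁ u + p₁ u • a₁) u := by
      rw [h2]; exact (hl u).mul (hf1.differentiable u).hasFDerivAt
    simp only [dirDeriv]
    rw [h3.fderiv]
    simp only [_root_.add_apply, _root_.smul_apply, smul_eq_mul]
    ring
  -- This identity lets the second differentiation be expressed through `p₂`. The extra multiple of
  -- `dirDeriv e p₁` in the next one cancels against the derivative of the factor `(a₀ e + t * a₁
  -- e)⁻¹`, so that `k₂` contains `p₂` alone.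
  have hq : (fun u => (a₁ u + c₁) * dirDeriv e p₁ u) = fun u => dirDeriv e p₂ u - a₁ e * p₁ u := by
    funext u; rw [hDp₂ u]; ring
  have hDq : (dirDeriv e fun u => (a₁ u + c₁) * dirDeriv e p₁ u) =
      fun u => dirDeriv e (dirDeriv e p₂) u - a₁ e * dirDeriv e p₁ u := by
    rw [hq]
    funext u
    have h3 := (hf2.differentiable_dirDeriv e u).hasFDerivAt.sub
      ((hf1.differentiable u).hasFDerivAt.const_mul (a₁ e))
    have h4 : HasFDerivAt (fun u => dirDeriv e p₂ u - a₁ e * p₁ u) _ u := h3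
    simp only [dirDeriv]
    simp only [dirDeriv] at h4
    rw [h4.fderiv]
    simp only [_root_.sub_apply, _root_.smul_apply, smul_eq_mul]
  have ht' : ∀ t ∈ Set.Icc (0 : ℝ) 1, a₀ e + t * a₁ e ≠ 0 := fun t ht => ha ▸ hne t ht
  have hk1 : ∀ t ∈ Set.Icc (0 : ℝ) 1, _ := fun t ht =>
    hasDerivAt_setIntegral_halfSpace (μ := μ) (c₀ := c₀) hf.differentiable hf.integrable
      hf1.integrable (hf1.integrable_dirDeriv e) (ht' t ht)
  have hi : ∀ t, Integrable (fun u => dirDeriv e (dirDeriv e p₂) u)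
      (μ.restrict {u | 0 < a₀ u + c₀ + t * (a₁ u + c₁)}) :=
    fun t => (hf2.integrable_dirDeriv_dirDeriv e).restrict
  have hi' : ∀ t, Integrable (fun u => a₁ e * dirDeriv e p₁ u)
      (μ.restrict {u | 0 < a₀ u + c₀ + t * (a₁ u + c₁)}) :=
    fun t => ((hf1.integrable_dirDeriv e).const_mul _).restrict
  have hk2 : ∀ t ∈ Set.Icc (0 : ℝ) 1, HasDerivAt (fun t => -(a₀ e + t * a₁ e)⁻¹ *
      ∫ u in {u | 0 < a₀ u + c₀ + t * (a₁ u + c₁)}, dirDeriv e p₁ u ∂μ)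
      ((1 + t * a₁ e)⁻¹ ^ 2 * ∫ u in {u | 0 < a₀ u + c₀ + t * (a₁ u + c₁)},
        dirDeriv e (dirDeriv e p₂) u ∂μ) t := fun t ht => by
    have h1 := hasDerivAt_setIntegral_halfSpace (μ := μ) (c₀ := c₀) (c₁ := c₁)
      (hf1.differentiable_dirDeriv e) (hf1.integrable_dirDeriv e)
      (by rw [hq]; exact (hf2.integrable_dirDeriv e).sub (hf1.integrable.const_mul _))
      (by rw [hDq]; exact (hf2.integrable_dirDeriv_dirDeriv e).sub
            ((hf1.integrable_dirDeriv e).const_mul _)) (ht' t ht)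
    have h2 : HasDerivAt (fun t => a₀ e + t * a₁ e) (a₁ e) t := by
      simpa using ((hasDerivAt_id t).mul_const (a₁ e)).const_add (a₀ e)
    refine ((h2.inv (ht' t ht)).neg.mul h1).congr_deriv ?_
    rw [hDq, integral_sub (hi t) (hi' t), integral_const_mul]
    have := hne t ht
    simp only [ha, Pi.neg_apply, Pi.inv_apply]
    generalize (∫ u in {u | 0 < a₀ u + c₀ + t * (a₁ u + c₁)}, dirDeriv e p₁ u ∂μ) = I₁
    generalize (∫ u in {u | 0 < a₀ u + c₀ + t * (a₁ u + c₁)}, dirDeriv e (dirDeriv e p₂) u ∂μ) = I₂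
    field_simp
    ring
  have := abs_taylor_two_le hk1 hk2 (B := B) (by
    intro t ht
    refine le_trans (le_of_eq ?_) (hB t ht)
    congr 2
    simp [halfSpaceIntegral, neg_lt_iff_pos_add])
  refine le_trans (le_of_eq ?_) this
  congr 1
  simp only [halfSpaceIntegral, neg_lt_iff_pos_add, zero_mul, add_zero, ha, one_mul, inv_one,
    one_pow]
  ring

end HalfSpace

/-! ### The loss probability given the asset deviations -/

noncomputable section

theorem setIntegral_sum_mul {E ι : Type*} [Fintype ι] [MeasurableSpace E] {μ : Measure E} (s : Set E) (c : ι → ℝ)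
    {p : ι → E → ℝ} (hp : ∀ i, Integrable (p i) μ) :
    ∫ u in s, ∑ i, c i * p i u ∂μ = ∑ i, c i * ∫ u in s, p i u ∂μ := by
  rw [integral_finsetSum _ fun i _ => ((hp i).const_mul (c i)).restrict]
  simp_rw [integral_const_mul]

section Linear

variable {E ι : Type*} [NormedAddCommGroup E] [NormedSpace ℝ E] [Fintype ι]

theorem dirDeriv_sum (e : E) (c : ι → ℝ) {p : ι → E → ℝ} (hp : ∀ i, Differentiable ℝ (p i)) :
    dirDeriv e (fun u => ∑ i, c i * p i u) = fun u => ∑ i, c i * dirDeriv e (p i) u := by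
  funext u
  have : HasFDerivAt (fun u => ∑ i, c i * p i u) (∑ i, c i • fderiv ℝ (p i) u) u :=
    HasFDerivAt.fun_sum fun i _ => (hp i u).hasFDerivAt.const_mul (c i)
  simp [dirDeriv, this.fderiv]

end Linear

variable {n : ℕ}

/-- The continuous linear functional `u ↦ ⟨w, u⟩`. -/
def dotCLM (w : Fin n → ℝ) : (Fin n → ℝ) →L[ℝ] ℝ :=
  ∑ i, w i • ContinuousLinearMap.proj i

@[simp]
theorem dotCLM_apply (w u : Fin n → ℝ) : dotCLM w u = w ⬝ᵥ u := by
  simp [dotCLM, dotProduct, _root_.sum_apply]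

theorem dotCLM_one_single (i₀ : Fin n) : dotCLM (1 : Fin n → ℝ) (Pi.single i₀ 1) = 1 := by
  simp

/-- The integral of `p` over `{y < ⟨1, ℓ⟩}`. -/
def tailIntegral (p : (Fin n → ℝ) → ℝ) : ℝ → ℝ :=
  halfSpaceIntegral volume (dotCLM 1) p

theorem tailIntegral_sum {ι : Type*} [Fintype ι] (c : ι → ℝ) {p : ι → (Fin n → ℝ) → ℝ}
    (hp : ∀ i, Integrable (p i)) (y : ℝ) :
    tailIntegral (fun u => ∑ i, c i * p i u) y = ∑ i, c i * tailIntegral (p i) y :=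
  setIntegral_sum_mul _ c hp

theorem abs_tailIntegral_le {p : (Fin n → ℝ) → ℝ} (hp : Integrable p) (y : ℝ) :
    |tailIntegral p y| ≤ ∫ u, ‖p u‖ :=
  abs_setIntegral_le _ hp

variable {fL : (Fin n → ℝ) → ℝ}

theorem RegularDensity.integrableC2_mul (h : RegularDensity fL) {Q : (Fin n → ℝ) → ℝ}
    (hQ : PolyGrowth 2 Q) : IntegrableC2 volume fun u => Q u * fL u :=
  hQ.integrableC2_mul h.contDiff h.integrable_deriv

theorem RegularDensity.integrableC2 (h : RegularDensity fL) : IntegrableC2 volume fL := by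
  simpa using h.integrableC2_mul ((PolyGrowth.const 1).mono (by norm_num))

theorem PolyGrowth.coord_sub (φ : Fin n → ℝ) (i : Fin n) :
    PolyGrowth 1 (fun u : Fin n → ℝ => u i - φ i) := by
  simpa [sub_eq_add_neg] using PolyGrowth.affine (ContinuousLinearMap.proj (R := ℝ) (φ := fun _ => ℝ) i) (-φ i)

theorem PolyGrowth.coord_sub_mul (φ : Fin n → ℝ) (i j : Fin n) :
    PolyGrowth 2 (fun u : Fin n → ℝ => (u i - φ i) * (u j - φ j)) :=
  (PolyGrowth.coord_sub φ i).mul (PolyGrowth.coord_sub φ j)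

/-- The first moment density `(ℓ_i - φ_i) f(ℓ)`. -/
def moment₁ (fL : (Fin n → ℝ) → ℝ) (φ : Fin n → ℝ) (i : Fin n) (u : Fin n → ℝ) : ℝ :=
  (u i - φ i) * fL u

/-- The second moment density `(ℓ_i - φ_i) (ℓ_j - φ_j) f(ℓ)`. -/
def moment₂ (fL : (Fin n → ℝ) → ℝ) (φ : Fin n → ℝ) (x : Fin n × Fin n) (u : Fin n → ℝ) : ℝ :=
  (u x.1 - φ x.1) * (u x.2 - φ x.2) * fL u

theorem RegularDensity.integrableC2_moment₁ (h : RegularDensity fL) (φ : Fin n → ℝ) (i : Fin n) :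
    IntegrableC2 volume (moment₁ fL φ i) :=
  h.integrableC2_mul ((PolyGrowth.coord_sub φ i).mono (by norm_num))

theorem RegularDensity.integrableC2_moment₂ (h : RegularDensity fL) (φ : Fin n → ℝ) (x : Fin n × Fin n) :
    IntegrableC2 volume (moment₂ fL φ x) :=
  h.integrableC2_mul (PolyGrowth.coord_sub_mul φ x.1 x.2)

/-- The probability of a loss larger than `m`, given the deviation `w` of the assets from `1`. -/
def lossProb (fL : (Fin n → ℝ) → ℝ) (φ w : Fin n → ℝ) (m : ℝ) : ℝ :=
  ∫ u in {u | m < 1 ⬝ᵥ u + w ⬝ᵥ (u - φ)}, fL u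

/-- The remainder of the second-order Taylor expansion of `lossProb` at `w = 0`. -/
def lossRem (fL : (Fin n → ℝ) → ℝ) (i₀ : Fin n) (φ w : Fin n → ℝ) (m : ℝ) : ℝ :=
  lossProb fL φ w m - tailIntegral fL m
    + ∑ i, w i * tailIntegral (dirDeriv (Pi.single i₀ 1) (moment₁ fL φ i)) m
    - 1 / 2 * ∑ x : Fin n × Fin n, w x.1 * w x.2 * tailIntegral
        (dirDeriv (Pi.single i₀ 1) (dirDeriv (Pi.single i₀ 1) (moment₂ fL φ x))) m

theorem setOf_lossProb_eq (φ w : Fin n → ℝ) (m t : ℝ) :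
    {u : Fin n → ℝ | m < 1 ⬝ᵥ u + (t • w) ⬝ᵥ (u - φ)} =
      {u | 0 < dotCLM 1 u + -m + t * (dotCLM w u + -(w ⬝ᵥ φ))} := by
  ext u
  simp only [Set.mem_ofPred_eq, dotCLM_apply, smul_dotProduct, dotProduct_sub, smul_eq_mul]
  constructor <;> intro h <;> linarith

/-- Joint continuity in the tilt and the level is what makes the later remainder estimate uniform
for levels near `q`. -/
theorem tendsto_setIntegral_lossProb {r : (Fin n → ℝ) → ℝ} (hr : Integrable r) (i₀ : Fin n)
    (φ : Fin n → ℝ) (q : ℝ) :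
    Tendsto (fun z : (Fin n → ℝ) × ℝ => ∫ u in {u | z.2 < 1 ⬝ᵥ u + z.1 ⬝ᵥ (u - φ)}, r u)
      (𝓝 (0, q)) (𝓝 (tailIntegral r q)) := by
  have := tendsto_setIntegral_pos (μ := (volume : Measure (Fin n → ℝ))) (l := 𝓝 (0, q))
    (ℓ := fun (z : (Fin n → ℝ) × ℝ) u => dotCLM 1 u + dotCLM z.1 (u - φ) - z.2)
    (ℓ₀ := fun u => dotCLM 1 u - q) (fun z => by fun_prop) (by fun_prop)
    (fun u => by
      have hc : Continuous fun z : (Fin n → ℝ) × ℝ => dotCLM 1 u + dotCLM z.1 (u - φ) - z.2 := by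
        simp only [dotCLM_apply, dotProduct]
        fun_prop
      simpa using hc.tendsto (0, q))
    (by simpa only [sub_eq_add_neg] using measure_affine_eq_zero (μ := volume) (dotCLM 1) (-q)
          (e := Pi.single i₀ 1) (by simp)) hr
  simpa [tailIntegral, halfSpaceIntegral] using this

/-- The loss probability has a second-order Taylor expansion at `w = 0`, locally uniformly in the
level. -/
theorem RegularDensity.exists_abs_lossRem_le (h : RegularDensity fL) (i₀ : Fin n)
    (φ : Fin n → ℝ) (q : ℝ) {ε : ℝ} (hε : 0 < ε) :
    ∃ δ > 0, ∀ w m, ‖w‖ < δ → |m - q| < δ → |lossRem fL i₀ φ w m| ≤ ε * ‖w‖ ^ 2 := by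
  set e : Fin n → ℝ := Pi.single i₀ 1 with he
  set r : Fin n × Fin n → (Fin n → ℝ) → ℝ := fun x => dirDeriv e (dirDeriv e (moment₂ fL φ x)) with hr
  have hri : ∀ x, Integrable (r x) := fun x => (h.integrableC2_moment₂ φ x).integrable_dirDeriv_dirDeriv e
  set N : ℝ := (Fintype.card (Fin n × Fin n) : ℝ) with hN
  -- Along the segment `t • w` the second derivative of the loss probability is the sum over pairs
  -- of `w x.1 * w x.2 * ψ x (t • w, m)`, so its oscillation is controlled by that of `ψ` near `(0,
  -- q)`.
  set ψ : Fin n × Fin n → (Fin n → ℝ) × ℝ → ℝ := fun x z =>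
    (1 + z.1 i₀)⁻¹ ^ 2 * ∫ u in {u | z.2 < 1 ⬝ᵥ u + z.1 ⬝ᵥ (u - φ)}, r x u with hψ
  have hψt : ∀ x, Tendsto (fun z => ψ x z - tailIntegral (r x) z.2) (𝓝 (0, q)) (𝓝 0) := fun x => by
    have h1 : Tendsto (fun z : (Fin n → ℝ) × ℝ => (1 + z.1 i₀)⁻¹ ^ 2) (𝓝 (0, q)) (𝓝 1) := by
      have : ContinuousAt (fun z : (Fin n → ℝ) × ℝ => (1 + z.1 i₀)⁻¹ ^ 2) (0, q) := by
        refine ContinuousAt.pow (ContinuousAt.inv₀ ?_ (by simp)) 2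
        fun_prop
      simpa [ContinuousAt] using this
    have h2 : Tendsto (fun z : (Fin n → ℝ) × ℝ => tailIntegral (r x) z.2) (𝓝 (0, q))
        (𝓝 (tailIntegral (r x) q)) :=
      ((continuous_halfSpaceIntegral (dotCLM_one_single i₀) (hri x)).comp continuous_snd).tendsto
        ((0, q) : (Fin n → ℝ) × ℝ)
    have h3 := (h1.mul (tendsto_setIntegral_lossProb (hri x) i₀ φ q)).sub h2
    rwa [one_mul, sub_self] at h3
  -- There are `N` pairs of indices, so their errors add up to at most `N / (N + 1) * ε`. The
  -- condition `‖z.1‖ < 1` below keeps `1 + t * w i₀` away from zero.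
  have hη : 0 < ε / (N + 1) := by positivity
  have hev : ∀ᶠ z in 𝓝 ((0 : Fin n → ℝ), q),
      (∀ x, |ψ x z - tailIntegral (r x) z.2| < ε / (N + 1)) ∧ ‖z.1‖ < 1 := by
    refine (eventually_all.2 fun x => ?_).and ?_
    · have := (hψt x).abs
      rw [abs_zero] at this
      exact this.eventually (gt_mem_nhds hη)
    · have : Tendsto (fun z : (Fin n → ℝ) × ℝ => ‖z.1‖) (𝓝 (0, q)) (𝓝 0) := by
        have hc : Continuous fun z : (Fin n → ℝ) × ℝ => ‖z.1‖ := by fun_prop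
        simpa using hc.tendsto (0, q)
      exact this.eventually (gt_mem_nhds one_pos)
  obtain ⟨δ, hδ, hball⟩ := Metric.eventually_nhds_iff.1 hev
  refine ⟨δ, hδ, fun w m hw hm => ?_⟩
  have hz : ∀ t ∈ Set.Icc (0 : ℝ) 1, (∀ x, |ψ x (t • w, m) - tailIntegral (r x) m| < ε / (N + 1)) ∧
      ‖t • w‖ < 1 := fun t ht => by
    refine hball (y := (t • w, m)) ?_
    rw [Prod.dist_eq, max_lt_iff]
    refine ⟨?_, by simpa [Real.dist_eq] using hm⟩
    rw [dist_zero_right, norm_smul, Real.norm_of_nonneg ht.1]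
    exact (mul_le_of_le_one_left (norm_nonneg _) ht.2).trans_lt hw
  have hdot : ∀ u, dotCLM w u + -(w ⬝ᵥ φ) = ∑ i, w i * (u i - φ i) := fun u => by
    rw [dotCLM_apply, ← sub_eq_add_neg, ← dotProduct_sub]
    rfl
  have hsum1 : (fun u : Fin n → ℝ => (dotCLM w u + -(w ⬝ᵥ φ)) * fL u) =
      fun u => ∑ i, w i * moment₁ fL φ i u := by
    funext u
    simp only [hdot, moment₁, Finset.sum_mul, mul_assoc]
  have hsum2 : (fun u : Fin n → ℝ => (dotCLM w u + -(w ⬝ᵥ φ)) * (dotCLM w u + -(w ⬝ᵥ φ)) * fL u) =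
      fun u => ∑ x : Fin n × Fin n, w x.1 * w x.2 * moment₂ fL φ x u := by
    funext u
    simp only [hdot, Finset.sum_mul_sum]
    simp only [moment₂, ← Finset.univ_product_univ, Finset.sum_product, Finset.sum_mul]
    refine Finset.sum_congr rfl fun i _ => Finset.sum_congr rfl fun j _ => ?_
    ring
  have hD1 : dirDeriv e (fun u : Fin n → ℝ => (dotCLM w u + -(w ⬝ᵥ φ)) * fL u) =
      fun u => ∑ i, w i * dirDeriv e (moment₁ fL φ i) u := by
    rw [hsum1, dirDeriv_sum e w fun i => (h.integrableC2_moment₁ φ i).differentiable]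
  have hD2 : dirDeriv e (dirDeriv e fun u : Fin n → ℝ =>
      (dotCLM w u + -(w ⬝ᵥ φ)) * (dotCLM w u + -(w ⬝ᵥ φ)) * fL u) =
      fun u => ∑ x : Fin n × Fin n, w x.1 * w x.2 * r x u := by
    rw [hsum2, dirDeriv_sum e (fun x : Fin n × Fin n => w x.1 * w x.2)
      fun x => (h.integrableC2_moment₂ φ x).differentiable,
      dirDeriv_sum e (fun x : Fin n × Fin n => w x.1 * w x.2)
      fun x => (h.integrableC2_moment₂ φ x).differentiable_dirDeriv e]
  have hwi : ∀ i, |w i| ≤ ‖w‖ := fun i => norm_le_pi_norm w i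
  have key := abs_setIntegral_halfSpace_taylor_le (μ := volume) (f := fL) (a₀ := dotCLM 1)
    (a₁ := dotCLM w) (c₀ := -m) (c₁ := -(w ⬝ᵥ φ)) (e := e) h.integrableC2
    (h.integrableC2_mul ((PolyGrowth.affine _ _).mono (by norm_num)))
    (h.integrableC2_mul ((PolyGrowth.affine _ _).mul (PolyGrowth.affine _ _)))
    (dotCLM_one_single i₀) (fun t ht => ?_) (B := ε * ‖w‖ ^ 2) (fun t ht => ?_)
  · rw [hD1, hD2, neg_neg] at key
    change |_ - tailIntegral fL m + tailIntegral _ m - 1 / 2 * tailIntegral _ m| ≤ _ at key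
    rw [tailIntegral_sum w fun i => (h.integrableC2_moment₁ φ i).integrable_dirDeriv e,
      tailIntegral_sum (fun x : Fin n × Fin n => w x.1 * w x.2) hri] at key
    have hset := setOf_lossProb_eq φ w m 1
    simp only [one_smul, one_mul] at hset
    rw [lossRem, lossProb, hset]
    exact key
  · have h1 := (norm_le_pi_norm (t • w) i₀).trans_lt (hz t ht).2
    rw [Real.norm_eq_abs] at h1
    have h2 : t * dotCLM w e = (t • w) i₀ := by simp [he]
    rw [h2]
    have := abs_lt.1 h1
    linarith
  · rw [hD2, neg_neg, ← setOf_lossProb_eq,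
      setIntegral_sum_mul _ (fun x : Fin n × Fin n => w x.1 * w x.2) hri]
    change |_ - tailIntegral _ m| ≤ _
    rw [tailIntegral_sum (fun x : Fin n × Fin n => w x.1 * w x.2) hri, Finset.mul_sum,
      ← Finset.sum_sub_distrib]
    have h2 : t * dotCLM w e = (t • w) i₀ := by simp [he]
    rw [h2]
    refine (Finset.abs_sum_le_sum_abs _ _).trans ?_
    calc _ ≤ ∑ x : Fin n × Fin n, ‖w‖ ^ 2 * (ε / (N + 1)) := by
          refine Finset.sum_le_sum fun x _ => ?_
          have h3 := ((hz t ht).1 x).le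
          rw [show (1 + (t • w) i₀)⁻¹ ^ 2 * (w x.1 * w x.2 *
              ∫ u in {u | m < 1 ⬝ᵥ u + (t • w) ⬝ᵥ (u - φ)}, r x u) -
              w x.1 * w x.2 * tailIntegral (r x) m =
              w x.1 * w x.2 * (ψ x (t • w, m) - tailIntegral (r x) m) by simp only [hψ]; ring,
            abs_mul, abs_mul, sq]
          gcongr
          · exact hwi _
          · exact hwi _
      _ = (N / (N + 1)) * (ε * ‖w‖ ^ 2) := by
          rw [Finset.sum_const, Finset.card_univ, nsmul_eq_mul, ← hN]
          ring
      _ ≤ ε * ‖w‖ ^ 2 := by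
          refine mul_le_of_le_one_left (by positivity) ?_
          rw [div_le_one (by positivity)]
          linarith

/-- The assets may deviate far from 1 even for small σ, so dominated convergence needs a quadratic
bound for every `w`. Away from zero the four terms of the remainder are bounded crudely, by `M`,
`M`, `a * ‖w‖` and `b * ‖w‖ ^ 2`. -/
theorem RegularDensity.exists_abs_lossRem_le_const_mul (h : RegularDensity fL) (i₀ : Fin n)
    (φ : Fin n → ℝ) (q : ℝ) :
    ∃ C, ∃ δ > 0, ∀ w m, |m - q| < δ → |lossRem fL i₀ φ w m| ≤ C * ‖w‖ ^ 2 := by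
  obtain ⟨δ, hδ, hnear⟩ := h.exists_abs_lossRem_le i₀ φ q one_pos
  set e : Fin n → ℝ := Pi.single i₀ 1 with he
  set M := ∫ u, ‖fL u‖ with hM
  set a : ℝ := ∑ i, ∫ u, ‖dirDeriv e (moment₁ fL φ i) u‖ with ha
  set b : ℝ := ∑ x, ∫ u, ‖dirDeriv e (dirDeriv e (moment₂ fL φ x)) u‖ with hb
  have hM0 : 0 ≤ M := integral_nonneg fun _ => norm_nonneg _
  have ha0 : 0 ≤ a := Finset.sum_nonneg fun _ _ => integral_nonneg fun _ => norm_nonneg _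
  have hb0 : 0 ≤ b := Finset.sum_nonneg fun _ _ => integral_nonneg fun _ => norm_nonneg _
  -- For `‖w‖ ≥ δ`, constants and linear terms become quadratic after multiplication by powers of
  -- `‖w‖ / δ ≥ 1`; the leading 1 serves the case `‖w‖ < δ`.
  refine ⟨1 + 2 * M / δ ^ 2 + a / δ + b, δ, hδ, fun w m hm => ?_⟩
  rcases lt_or_ge ‖w‖ δ with hw | hw
  · refine (hnear w m hw hm).trans ?_
    gcongr
    have : 0 ≤ 2 * M / δ ^ 2 + a / δ + b := by positivity
    linarith
  have hwi : ∀ i, |w i| ≤ ‖w‖ := fun i => norm_le_pi_norm w i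
  have h0 : |lossProb fL φ w m| ≤ M := abs_setIntegral_le _ h.integrableC2.integrable
  have h1 : |tailIntegral fL m| ≤ M := abs_tailIntegral_le h.integrableC2.integrable m
  have h2 : |∑ i, w i * tailIntegral (dirDeriv e (moment₁ fL φ i)) m| ≤ a * ‖w‖ := by
    refine (Finset.abs_sum_le_sum_abs _ _).trans ?_
    rw [ha, Finset.sum_mul]
    refine Finset.sum_le_sum fun i _ => ?_
    rw [abs_mul, mul_comm]
    gcongr
    · exact abs_tailIntegral_le ((h.integrableC2_moment₁ φ i).integrable_dirDeriv e) m
    · exact hwi i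
  have h3 : |∑ x : Fin n × Fin n, w x.1 * w x.2 *
      tailIntegral (dirDeriv e (dirDeriv e (moment₂ fL φ x))) m| ≤ b * ‖w‖ ^ 2 := by
    refine (Finset.abs_sum_le_sum_abs _ _).trans ?_
    rw [hb, Finset.sum_mul]
    refine Finset.sum_le_sum fun x _ => ?_
    rw [abs_mul, abs_mul, mul_comm, sq]
    gcongr
    · exact abs_tailIntegral_le ((h.integrableC2_moment₂ φ x).integrable_dirDeriv_dirDeriv e) m
    · exact hwi _
    · exact hwi _
  have h4 : 1 ≤ ‖w‖ / δ := (one_le_div hδ).2 hw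
  have h5 : 2 * M ≤ 2 * M / δ ^ 2 * ‖w‖ ^ 2 := by
    rw [div_mul_eq_mul_div, mul_div_assoc, ← div_pow]
    exact le_mul_of_one_le_right (by positivity) (one_le_pow₀ h4)
  have h6 : a * ‖w‖ ≤ a / δ * ‖w‖ ^ 2 := by
    rw [show a / δ * ‖w‖ ^ 2 = a * ‖w‖ * (‖w‖ / δ) by ring]
    exact le_mul_of_one_le_right (by positivity) h4
  rw [lossRem]
  rw [abs_le] at *
  constructor <;> nlinarith [sq_nonneg ‖w‖, mul_nonneg hb0 (sq_nonneg ‖w‖)]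

end

/-! ### Distribution, density and truncated moments of the total claim -/

noncomputable section

section Slab

theorem IntegrableC2.iteratedDeriv_tailIntegral {n : ℕ} {p : (Fin n → ℝ) → ℝ}
    (h : IntegrableC2 volume p) (i₀ : Fin n) :
    iteratedDeriv 2 (tailIntegral p) =
      tailIntegral (dirDeriv (Pi.single i₀ 1) (dirDeriv (Pi.single i₀ 1) p)) :=
  h.iteratedDeriv_halfSpaceIntegral (dotCLM_one_single i₀)

variable {n : ℕ} {fL : (Fin n → ℝ) → ℝ}

/-- A continuous positive density gives the slab `{y < ⟨1, ℓ⟩ ≤ y + 1 / N}` mass of order `1 / N`. -/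
theorem exists_slab_mass_le (i₀ : Fin n) (hc : Continuous fL) (hpos : ∀ u, 0 < fL u)
    (hfi : Integrable fL) (y : ℝ) :
    ∃ κ > 0, ∀ N : ℕ, 0 < N →
      κ ≤ N * (tailIntegral fL y - tailIntegral fL (y + (N : ℝ)⁻¹)) := by
  set e : Fin n → ℝ := Pi.single i₀ 1 with he
  have hTe : dotCLM 1 e = 1 := dotCLM_one_single i₀
  have hne : ‖e‖ = 1 := by simp [he, Pi.norm_single]
  -- The ball of radius `R - 1` contains `(y + 1 / 2) • e`, a point of the unit slab. The spare unit
  -- of radius absorbs translations by at most `e`, and on the larger closed ball the density is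
  -- bounded below by its minimum.
  set R : ℝ := |y + 1 / 2| + 2 with hR
  obtain ⟨u₀, -, hu₀⟩ := (isCompact_closedBall (0 : Fin n → ℝ) R).exists_isMinOn
    ⟨0, by simp only [Metric.mem_closedBall, dist_self]; positivity⟩ hc.continuousOn
  set B' : Set (Fin n → ℝ) := Metric.ball 0 (R - 1) ∩ dotCLM 1 ⁻¹' Set.Ioo y (y + 1) with hB'
  have hB'open : IsOpen B' := Metric.isOpen_ball.inter (isOpen_Ioo.preimage (dotCLM 1).continuous)
  have hB'ne : B'.Nonempty := by
    refine ⟨(y + 1 / 2) • e, ?_, ?_⟩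
    · rw [mem_ball_zero_iff, norm_smul, hne, Real.norm_eq_abs, hR]
      linarith
    · rw [Set.mem_preimage, map_smul, hTe, smul_eq_mul]
      constructor <;> linarith
  have hB'pos : 0 < volume B' := hB'open.measure_pos _ hB'ne
  have hB'fin : volume B' ≠ ⊤ :=
    ((measure_mono Set.inter_subset_left).trans_lt Metric.isBounded_ball.measure_lt_top).ne
  refine ⟨fL u₀ * volume.real B', mul_pos (hpos _) (ENNReal.toReal_pos hB'pos.ne' hB'fin),
    fun N hN => ?_⟩
  have hN' : (0 : ℝ) < N := by exact_mod_cast hN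
  set slab : Set (Fin n → ℝ) := dotCLM 1 ⁻¹' Set.Ioc y (y + (N : ℝ)⁻¹) with hslab
  have hslabm : MeasurableSet slab := (dotCLM 1).continuous.measurable measurableSet_Ioc
  set S : Set (Fin n → ℝ) := Metric.closedBall 0 R ∩ slab with hS
  have hSm : MeasurableSet S := measurableSet_closedBall.inter hslabm
  have hSfin : volume S ≠ ⊤ :=
    ((measure_mono Set.inter_subset_left).trans_lt Metric.isBounded_closedBall.measure_lt_top).ne
  -- `N` translates of the truncated thin slab cover a fixed open set, so the volume of the thin one
  -- is at least that of `B'` divided by `N`.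
  have hcover : B' ⊆ ⋃ k ∈ Finset.range N, (fun u => u + -(((k : ℝ) / N) • e)) ⁻¹' S := by
    rintro u ⟨hu1, hu2, hu3⟩
    set x : ℝ := N * (dotCLM 1 u - y) with hx
    have hx0 : 0 < x := mul_pos hN' (by linarith)
    have hxN : x < N := by
      have : dotCLM 1 u - y < 1 := by linarith
      nlinarith
    have hceil : 0 < ⌈x⌉₊ := Nat.ceil_pos.2 hx0
    have hceilN : ⌈x⌉₊ ≤ N := Nat.ceil_le.2 hxN.le
    -- The thin slab is open below and closed above, hence the ceiling minus one instead of the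
    -- floor: `k < x ≤ k + 1`.
    obtain ⟨k, hk⟩ : ∃ k, ⌈x⌉₊ = k + 1 := ⟨⌈x⌉₊ - 1, by omega⟩
    have hkx : (k : ℝ) < x := Nat.lt_ceil.1 (by omega)
    have hkx' : x ≤ k + 1 := by exact_mod_cast hk ▸ Nat.le_ceil x
    have hk1 : (k : ℝ) / N ≤ 1 := by
      rw [div_le_one hN']; linarith
    simp only [Set.mem_iUnion, Finset.mem_range, Set.mem_preimage]
    refine ⟨k, by omega, ?_, ?_⟩
    · rw [mem_closedBall_zero_iff]
      rw [mem_ball_zero_iff] at hu1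
      refine (norm_add_le _ _).trans ?_
      rw [norm_neg, norm_smul, hne, mul_one, Real.norm_of_nonneg (by positivity)]
      linarith
    · rw [hslab, Set.mem_preimage, map_add, map_neg, map_smul, hTe, smul_eq_mul, mul_one]
      have h1 : dotCLM 1 u - y = x / N := by rw [hx]; field_simp
      have h2 : (k : ℝ) / N < x / N := by gcongr
      have h3 : x / N ≤ k / N + (N : ℝ)⁻¹ := by
        rw [← one_div, ← add_div]; gcongr
      constructor <;> linarith
  have hvol : volume.real B' ≤ N * volume.real S := by
    have h1 : volume B' ≤ N * volume S := by
      refine (measure_mono hcover).trans ((measure_biUnion_finset_le _ _).trans ?_)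
      simp only [measure_preimage_add_right, Finset.sum_const, Finset.card_range, nsmul_eq_mul,
        le_refl]
    have := ENNReal.toReal_mono (ENNReal.mul_ne_top (by simp) hSfin) h1
    simpa [Measure.real] using this
  have hdiff : tailIntegral fL y - tailIntegral fL (y + (N : ℝ)⁻¹) = ∫ u in slab, fL u := by
    have hunion : {u : Fin n → ℝ | y < dotCLM 1 u} = slab ∪ {u | y + (N : ℝ)⁻¹ < dotCLM 1 u} := by
      ext u
      have : (0 : ℝ) < (N : ℝ)⁻¹ := by positivity
      simp only [hslab, Set.mem_ofPred_eq, Set.mem_union, Set.mem_preimage, Set.mem_Ioc]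
      constructor
      · intro h
        rcases le_or_gt (dotCLM 1 u) (y + (N : ℝ)⁻¹) with h' | h'
        · exact .inl ⟨h, h'⟩
        · exact .inr h'
      · rintro (h | h)
        · exact h.1
        · linarith
    have hdisj : Disjoint slab {u | y + (N : ℝ)⁻¹ < dotCLM 1 u} := by
      rw [Set.disjoint_left]
      intro u hu hu'
      exact absurd hu.2 (not_le.2 hu')
    rw [tailIntegral, halfSpaceIntegral, hunion, setIntegral_union hdisj
      (measurableSet_lt measurable_const (dotCLM 1).continuous.measurable)
      hfi.integrableOn hfi.integrableOn, halfSpaceIntegral]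
    ring
  have hmass : fL u₀ * volume.real S ≤ ∫ u in slab, fL u := by
    calc fL u₀ * volume.real S = ∫ _ in S, fL u₀ := by
          rw [setIntegral_const, smul_eq_mul, mul_comm]
      _ ≤ ∫ u in S, fL u :=
          setIntegral_mono_on (integrableOn_const hSfin) hfi.integrableOn hSm
            fun u hu => hu₀ hu.1
      _ ≤ ∫ u in slab, fL u :=
          setIntegral_mono_set hfi.integrableOn (.of_forall fun u => (hpos u).le)
            (LE.le.eventuallyLE Set.inter_subset_right)
  rw [hdiff]
  calc fL u₀ * volume.real B' ≤ fL u₀ * (N * volume.real S) := by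
        gcongr
        exact (hpos _).le
    _ = N * (fL u₀ * volume.real S) := by ring
    _ ≤ _ := by gcongr

end Slab

variable {Ω : Type*} [MeasurableSpace Ω] {P : Measure Ω} {n : ℕ} {X L : Ω → Fin n → ℝ} {fL : (Fin n → ℝ) → ℝ}

theorem measurable_totalClaim (hL : Measurable L) : Measurable (totalClaim L) := by
  unfold totalClaim
  simp only [dotProduct]
  fun_prop

theorem StandingAssumptions.setIntegral_comp_claim (h : StandingAssumptions P X L fL)
    (hf : Measurable fL) {s : Set (Fin n → ℝ)} (hs : MeasurableSet s) {g : (Fin n → ℝ) → ℝ}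
    (hg : Measurable g) : ∫ ω in L ⁻¹' s, g (L ω) ∂P = ∫ u in s, g u * fL u := by
  rw [← setIntegral_map hs hg.aestronglyMeasurable h.measurable_claim.aemeasurable,
    h.claim_density, setIntegral_withDensity_eq_setIntegral_toReal_smul (by fun_prop)
      (.of_forall fun _ => ENNReal.ofReal_lt_top) _ hs]
  refine integral_congr_ae (.of_forall fun u => ?_)
  simp only [ENNReal.toReal_ofReal (h.density_pos u).le, smul_eq_mul, mul_comm]

theorem StandingAssumptions.setIntegral_totalClaim (h : StandingAssumptions P X L fL)
    (hf : Measurable fL) {g : (Fin n → ℝ) → ℝ} (hg : Measurable g) (y : ℝ) :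
    ∫ ω in {ω | y < totalClaim L ω}, g (L ω) ∂P = tailIntegral (fun u => g u * fL u) y := by
  have := h.setIntegral_comp_claim hf (s := {u | y < dotCLM 1 u})
    (measurableSet_lt measurable_const (dotCLM 1).continuous.measurable) hg
  simp only [dotCLM_apply] at this
  simpa only [tailIntegral, halfSpaceIntegral, dotCLM_apply] using! this

theorem RegularDensity.measurable (h : RegularDensity fL) : Measurable fL :=
  h.contDiff.continuous.measurable

theorem StandingAssumptions.measureReal_lt_totalClaim (h : StandingAssumptions P X L fL)
    (hf : Measurable fL) (y : ℝ) : P.real {ω | y < totalClaim L ω} = tailIntegral fL y := by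
  simpa using h.setIntegral_totalClaim hf (g := fun _ => 1) measurable_const y

/-- The matrix enters linearly, through fixed scalar functions of the level. All smoothness and all
dependence on `y` thus sit in tail integrals that do not depend on σ. -/
theorem StandingAssumptions.quadK_eq (h : StandingAssumptions P X L fL)
    (hfL : RegularDensity fL) (A : Matrix (Fin n) (Fin n) ℝ) (φ : Fin n → ℝ) (y : ℝ) :
    quadK P L A (fun ω => φ - L ω) y =
      ∑ x : Fin n × Fin n, A x.1 x.2 * tailIntegral (moment₂ fL φ x) y := by
  rw [← tailIntegral_sum (fun x : Fin n × Fin n => A x.1 x.2)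
    fun x => (hfL.integrableC2_moment₂ φ x).integrable]
  have h1 := h.setIntegral_totalClaim hfL.measurable (g := fun u => (φ - u) ⬝ᵥ (A *ᵥ (φ - u)))
    (by simp only [dotProduct, mulVec]; fun_prop) y
  rw [quadK, h1]
  congr 1
  funext u
  simp only [dotProduct, mulVec, moment₂, ← Finset.univ_product_univ, Finset.sum_product,
    Finset.sum_mul, Finset.mul_sum, Pi.sub_apply]
  exact Finset.sum_congr rfl fun i _ => Finset.sum_congr rfl fun j _ => by ring

theorem StandingAssumptions.claimK_apply (h : StandingAssumptions P X L fL)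
    (hfL : RegularDensity fL) (y : ℝ) (i : Fin n) :
    claimK P L y i = tailIntegral (moment₁ fL 0 i) y := by
  have h1 := h.setIntegral_totalClaim hfL.measurable (g := fun u => u i - (0 : Fin n → ℝ) i)
    (by fun_prop) y
  rw [claimK, eval_integral fun i => (h.integrable_claim i).restrict]
  have h2 : moment₁ fL 0 i = fun u => u i * fL u := by
    funext u
    simp [moment₁]
  simpa [h2] using h1

theorem StandingAssumptions.hasDerivAt_claimK (h : StandingAssumptions P X L fL)
    (hfL : RegularDensity fL) (i₀ : Fin n) (y : ℝ) :
    HasDerivAt (claimK P L)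
      (fun i => tailIntegral (dirDeriv (Pi.single i₀ 1) (moment₁ fL 0 i)) y) y := by
  rw [hasDerivAt_pi]
  intro i
  simp_rw [h.claimK_apply hfL]
  exact (hfL.integrableC2_moment₁ 0 i).hasDerivAt_halfSpaceIntegral (dotCLM_one_single i₀) y

theorem StandingAssumptions.contDiff_claimK (h : StandingAssumptions P X L fL)
    (hfL : RegularDensity fL) (i₀ : Fin n) : ContDiff ℝ 2 (claimK P L) := by
  rw [contDiff_pi]
  intro i
  simp_rw [h.claimK_apply hfL]
  exact (hfL.integrableC2_moment₁ 0 i).contDiff_halfSpaceIntegral (dotCLM_one_single i₀)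

theorem StandingAssumptions.iteratedDeriv_claimK (h : StandingAssumptions P X L fL)
    (hfL : RegularDensity fL) (i₀ : Fin n) (y : ℝ) (i : Fin n) :
    iteratedDeriv 2 (claimK P L) y i = iteratedDeriv 2 (tailIntegral (moment₁ fL 0 i)) y := by
  rw [iteratedDeriv_succ, iteratedDeriv_one,
    funext fun y => (h.hasDerivAt_claimK hfL i₀ y).deriv,
    (hfL.integrableC2_moment₁ 0 i).iteratedDeriv_tailIntegral i₀]
  have : HasDerivAt (fun y i => tailIntegral (dirDeriv (Pi.single i₀ 1) (moment₁ fL 0 i)) y)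
      (fun i => tailIntegral (dirDeriv (Pi.single i₀ 1)
        (dirDeriv (Pi.single i₀ 1) (moment₁ fL 0 i))) y) y :=
    hasDerivAt_pi.2 fun i => (hfL.integrableC2_moment₁ 0 i).hasDerivAt_halfSpaceIntegral_dirDeriv
      (dotCLM_one_single i₀) y
  rw [this.deriv]

theorem StandingAssumptions.contDiff_quadK (h : StandingAssumptions P X L fL)
    (hfL : RegularDensity fL) (i₀ : Fin n) (A : Matrix (Fin n) (Fin n) ℝ) (φ : Fin n → ℝ) :
    ContDiff ℝ 2 (quadK P L A fun ω => φ - L ω) := by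
  rw [funext (h.quadK_eq hfL A φ)]
  exact ContDiff.sum fun x _ => contDiff_const.mul
    ((hfL.integrableC2_moment₂ φ x).contDiff_halfSpaceIntegral (dotCLM_one_single i₀))

theorem iteratedDeriv_two_sum_mul {ι : Type*} [Fintype ι] (c : ι → ℝ) {g : ι → ℝ → ℝ}
    (hg : ∀ i, ContDiff ℝ 2 (g i)) (y : ℝ) :
    iteratedDeriv 2 (fun y => ∑ i, c i * g i y) y = ∑ i, c i * iteratedDeriv 2 (g i) y := by
  rw [iteratedDeriv_fun_sum fun i _ => (contDiff_const.mul (hg i)).contDiffAt]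
  exact Finset.sum_congr rfl fun i _ => by
    rw [iteratedDeriv_const_mul_field]

theorem StandingAssumptions.iteratedDeriv_quadK (h : StandingAssumptions P X L fL)
    (hfL : RegularDensity fL) (i₀ : Fin n) (A : Matrix (Fin n) (Fin n) ℝ) (φ : Fin n → ℝ) (y : ℝ) :
    iteratedDeriv 2 (quadK P L A fun ω => φ - L ω) y =
      ∑ x : Fin n × Fin n, A x.1 x.2 * iteratedDeriv 2 (tailIntegral (moment₂ fL φ x)) y := by
  rw [funext (h.quadK_eq hfL A φ)]
  exact iteratedDeriv_two_sum_mul _ (fun x =>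
    (hfL.integrableC2_moment₂ φ x).contDiff_halfSpaceIntegral (dotCLM_one_single i₀)) y

variable [IsProbabilityMeasure P]

theorem StandingAssumptions.cdf_totalClaim (h : StandingAssumptions P X L fL)
    (hf : Measurable fL) (y : ℝ) :
    cdf (P.map (totalClaim L)) y = 1 - tailIntegral fL y := by
  have hm := measurable_totalClaim h.measurable_claim
  have : IsProbabilityMeasure (P.map (totalClaim L)) :=
    Measure.isProbabilityMeasure_map hm.aemeasurable
  rw [cdf_eq_real, map_measureReal_apply hm measurableSet_Iic, ← h.measureReal_lt_totalClaim hf,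
    ← probReal_compl_eq_one_sub (measurableSet_lt measurable_const hm)]
  congr 1
  ext ω
  simp

theorem StandingAssumptions.hasDerivAt_cdf (h : StandingAssumptions P X L fL)
    (hfL : RegularDensity fL) (i₀ : Fin n) (y : ℝ) :
    HasDerivAt (fun y => cdf (P.map (totalClaim L)) y)
      (-tailIntegral (dirDeriv (Pi.single i₀ 1) fL) y) y := by
  rw [funext (h.cdf_totalClaim hfL.measurable)]
  exact (hfL.integrableC2.hasDerivAt_halfSpaceIntegral (dotCLM_one_single i₀) y).const_sub 1

theorem StandingAssumptions.totalDensity_eq (h : StandingAssumptions P X L fL)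
    (hfL : RegularDensity fL) (i₀ : Fin n) :
    totalDensity P L = fun y => -tailIntegral (dirDeriv (Pi.single i₀ 1) fL) y :=
  funext fun y => (h.hasDerivAt_cdf hfL i₀ y).deriv

theorem StandingAssumptions.contDiff_totalDensity (h : StandingAssumptions P X L fL)
    (hfL : RegularDensity fL) (i₀ : Fin n) : ContDiff ℝ 1 (totalDensity P L) := by
  rw [h.totalDensity_eq hfL i₀]
  exact (hfL.integrableC2.contDiff_halfSpaceIntegral_dirDeriv (dotCLM_one_single i₀)).neg

theorem StandingAssumptions.deriv_totalDensity (h : StandingAssumptions P X L fL)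
    (hfL : RegularDensity fL) (i₀ : Fin n) (y : ℝ) :
    deriv (totalDensity P L) y = -iteratedDeriv 2 (tailIntegral fL) y := by
  rw [h.totalDensity_eq hfL i₀, hfL.integrableC2.iteratedDeriv_tailIntegral i₀]
  exact (hfL.integrableC2.hasDerivAt_halfSpaceIntegral_dirDeriv (dotCLM_one_single i₀) y).neg.deriv

theorem StandingAssumptions.hasDerivAt_tailIntegral (h : StandingAssumptions P X L fL)
    (hfL : RegularDensity fL) (i₀ : Fin n) (y : ℝ) :
    HasDerivAt (tailIntegral fL) (-totalDensity P L y) y := by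
  rw [h.totalDensity_eq hfL i₀, neg_neg]
  exact hfL.integrableC2.hasDerivAt_halfSpaceIntegral (dotCLM_one_single i₀) y

/-- The difference quotients of the tail along the steps `1 / (N + 1)` stay below `-κ` by the slab
estimate, and so does their limit, which is minus the density. -/
theorem StandingAssumptions.totalDensity_pos (h : StandingAssumptions P X L fL)
    (hfL : RegularDensity fL) (i₀ : Fin n) (y : ℝ) : 0 < totalDensity P L y := by
  obtain ⟨κ, hκ, hle⟩ := exists_slab_mass_le i₀ hfL.contDiff.continuous h.density_pos
    hfL.integrableC2.integrable y
  have hd := hasDerivAt_iff_tendsto_slope_zero.1 (h.hasDerivAt_tailIntegral hfL i₀ y)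
  have hseq : Tendsto (fun N : ℕ => ((N : ℝ) + 1)⁻¹) atTop (𝓝[≠] 0) := by
    refine tendsto_nhdsWithin_iff.2 ⟨?_, .of_forall fun N => ?_⟩
    · simpa using tendsto_one_div_add_atTop_nhds_zero_nat (𝕜 := ℝ)
    · simp only [Set.mem_compl_iff, Set.mem_singleton_iff, inv_eq_zero]
      positivity
  have hlim := hd.comp hseq
  have := le_of_tendsto hlim (b := -κ) (.of_forall fun N => by
    have := hle (N + 1) (by omega)
    push_cast at this
    simp only [Function.comp_apply, inv_inv, smul_eq_mul]
    linarith)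
  linarith

theorem StandingAssumptions.map_totalClaim (h : StandingAssumptions P X L fL)
    (hfL : RegularDensity fL) (i₀ : Fin n) :
    P.map (totalClaim L) = volume.withDensity fun y => ENNReal.ofReal (totalDensity P L y) := by
  have hm := measurable_totalClaim h.measurable_claim
  have : IsProbabilityMeasure (P.map (totalClaim L)) :=
    Measure.isProbabilityMeasure_map hm.aemeasurable
  have hcont := (h.contDiff_totalDensity hfL i₀).continuous
  refine Measure.ext_of_Ioc _ _ fun a b hab => ?_
  have h1 : P.map (totalClaim L) (Set.Ioc a b) =
      ENNReal.ofReal (cdf (P.map (totalClaim L)) b - cdf (P.map (totalClaim L)) a) := by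
    conv_lhs => rw [← measure_cdf (P.map (totalClaim L))]
    rw [StieltjesFunction.measure_Ioc]
  have hd : ∀ y, HasDerivAt (fun y => cdf (P.map (totalClaim L)) y) (totalDensity P L y) y := by
    intro y
    rw [h.totalDensity_eq hfL i₀]
    exact h.hasDerivAt_cdf hfL i₀ y
  rw [h1, withDensity_apply _ measurableSet_Ioc, ← ofReal_integral_eq_lintegral_ofReal
    (hcont.integrableOn_Ioc) (.of_forall fun y => (h.totalDensity_pos hfL i₀ y).le),
    ← intervalIntegral.integral_of_le hab.le,
    intervalIntegral.integral_eq_sub_of_hasDerivAt (fun y _ => hd y) (hcont.intervalIntegrable _ _)]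

/-- Continuity of the distribution function gives equality at the infimum: the level set is closed,
and every point to its left has smaller mass than `1 - α`. -/
theorem StandingAssumptions.tailIntegral_quantile (h : StandingAssumptions P X L fL)
    (hfL : RegularDensity fL) (i₀ : Fin n) {α : ℝ} (hα0 : 0 < α) (hα1 : α < 1) :
    tailIntegral fL (quantile P (totalClaim L) (1 - α)) = α := by
  have hm := measurable_totalClaim h.measurable_claim
  have : IsProbabilityMeasure (P.map (totalClaim L)) :=
    Measure.isProbabilityMeasure_map hm.aemeasurable
  have hcont : Continuous fun y => cdf (P.map (totalClaim L)) y :=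
    continuous_iff_continuousAt.2 fun y => (h.hasDerivAt_cdf hfL i₀ y).continuousAt
  set F := cdf (P.map (totalClaim L)) with hF
  set s : Set ℝ := {y : ℝ | 1 - α ≤ F y} with hs
  have hclosed : IsClosed s := isClosed_le continuous_const hcont
  have hne : s.Nonempty :=
    (((tendsto_cdf_atTop (P.map (totalClaim L))).eventually
      (lt_mem_nhds (show 1 - α < 1 by linarith))).exists).imp fun y hy => le_of_lt hy
  have hbdd : BddBelow s := by
    obtain ⟨b, hb⟩ := ((tendsto_cdf_atBot (P.map (totalClaim L))).eventually
      (gt_mem_nhds (show 0 < 1 - α by linarith))).exists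
    refine ⟨b, fun y hy => le_of_not_gt fun hyb => ?_⟩
    have h1 : F y ≤ F b := monotone_cdf _ hyb.le
    have h2 : 1 - α ≤ F y := hy
    have h3 : F b < 1 - α := hb
    linarith
  have hq1 : 1 - α ≤ F (sInf s) := hclosed.csInf_mem hne hbdd
  have hq2 : F (sInf s) ≤ 1 - α := by
    have hlt : Tendsto (fun y => F y) (𝓝[<] (sInf s)) (𝓝 (F (sInf s))) :=
      (hcont.tendsto _).mono_left nhdsWithin_le_nhds
    refine le_of_tendsto hlt ?_
    filter_upwards [self_mem_nhdsWithin] with y hy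
    exact le_of_not_ge fun hge => absurd (csInf_le hbdd hge) (not_le.2 hy)
  have := h.cdf_totalClaim hfL.measurable (sInf s)
  change tailIntegral fL (sInf s) = α
  rw [← hF] at this
  linarith

theorem StandingAssumptions.valueAtRisk_neg_totalClaim (h : StandingAssumptions P X L fL)
    (hfL : RegularDensity fL) (α : ℝ) :
    valueAtRisk P α (fun ω => -totalClaim L ω) = quantile P (totalClaim L) (1 - α) := by
  unfold valueAtRisk quantile
  congr 1
  ext m
  have : {ω | -totalClaim L ω + m < 0} = {ω | m < totalClaim L ω} := by
    ext ω
    simp only [Set.mem_ofPred_eq]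
    constructor <;> intro h <;> linarith
  rw [Set.mem_ofPred_eq, Set.mem_ofPred_eq, this, h.measureReal_lt_totalClaim hfL.measurable,
    h.cdf_totalClaim hfL.measurable]
  constructor <;> intro h <;> linarith

end

/-! ### Assets of small volatility -/

noncomputable section

theorem abs_exp_sub_one_le_mul_exp (x : ℝ) : |Real.exp x - 1| ≤ |x| * Real.exp |x| := by
  rcases le_total 0 x with hx | hx
  · rw [abs_of_nonneg hx, abs_of_nonneg (by linarith [Real.one_le_exp hx])]
    have h1 := Real.add_one_le_exp (-x)
    have h2 : Real.exp (-x) * Real.exp x = 1 := by rw [← Real.exp_add]; simp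
    nlinarith [Real.exp_pos x]
  · rw [abs_of_nonpos hx, abs_of_nonpos (by linarith [Real.exp_le_one_iff.2 hx])]
    have h1 := Real.add_one_le_exp x
    have h2 := Real.one_le_exp (show 0 ≤ -x by linarith)
    nlinarith


variable {Ω : Type*} [MeasurableSpace Ω] {P : Measure Ω} {n : ℕ} {X L : Ω → Fin n → ℝ} {fL : (Fin n → ℝ) → ℝ}

theorem volatility_nonneg (κ : VolKind) (P : Measure Ω) (X : Ω → Fin n → ℝ) :
    0 ≤ volatility κ P X :=
  Real.iSup_nonneg fun _ => Real.sqrt_nonneg _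

theorem VolKind.measurable_scale (κ : VolKind) : Measurable κ.scale := by
  cases κ
  · exact measurable_id
  · exact Real.measurable_log

/-- The assets with volatility `σ` are a measurable function of the assets. -/
theorem exists_measurable_assetFamily (κ : VolKind) (σ : ℝ) :
    ∃ g : (Fin n → ℝ) → Fin n → ℝ, Measurable g ∧ ∀ ω, assetFamily κ P X σ ω = g (X ω) := by
  cases κ
  · refine ⟨fun x i => 1 + σ * ((x i - ∫ ω', X ω' i ∂P) / volatility .normal P X), ?_, fun ω => rfl⟩
    fun_prop
  · refine ⟨fun x i => Real.exp (σ * ((Real.log (x i) - ∫ ω', Real.log (X ω' i) ∂P) /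
      volatility .logNormal P X)) / mgf (fun ω' => normalized .logNormal P X ω' i) P σ, ?_,
      fun ω => rfl⟩
    have := Real.measurable_log
    fun_prop

theorem measurable_assetFamily (hX : Measurable X) (κ : VolKind) (σ : ℝ) :
    Measurable (assetFamily κ P X σ) := by
  obtain ⟨g, hg, h⟩ := exists_measurable_assetFamily (P := P) (X := X) κ σ
  rw [funext h]
  exact hg.comp hX

variable [IsProbabilityMeasure P]

/-- A centred random variable with exponential moments, exponentially tilted by a small `σ`,
deviates from `1` by at most `σ Z` with `Z` square integrable. -/
theorem exists_abs_exp_div_mgf_sub_one_le {Y : Ω → ℝ} (hm : Measurable Y) (hi : Integrable Y P)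
    (h0 : ∫ ω, Y ω ∂P = 0) {c : ℝ} (hc : 0 < c)
    (hexp : Integrable (fun ω => Real.exp (c * |Y ω|)) P) :
    ∃ Z : Ω → ℝ, MemLp Z 2 P ∧ (∀ ω, 0 ≤ Z ω) ∧ ∀ σ, 0 < σ → σ ≤ c / 4 → 0 < mgf Y P σ ∧
      ∫ ω, Real.exp (σ * Y ω) / mgf Y P σ ∂P = 1 ∧
      ∀ ω, |Real.exp (σ * Y ω) / mgf Y P σ - 1| ≤ σ * Z ω := by
  -- The exponent `c / 2` makes `U ^ 2` a multiple of the integrable `exp (c * |Y|)`. It is split in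
  -- two: one `c / 4` bounds `|Y|` through `x ≤ exp x`, the other bounds `exp (σ * |Y|)` for `σ ≤ c
  -- / 4`.
  set U : Ω → ℝ := fun ω => 4 / c * Real.exp (c / 2 * |Y ω|) with hU
  have hU0 : ∀ ω, 0 ≤ U ω := fun ω => by positivity
  have hUm : Measurable U := by fun_prop
  have hU2 : MemLp U 2 P := by
    rw [memLp_two_iff_integrable_sq hUm.aestronglyMeasurable]
    refine (hexp.const_mul ((4 / c) ^ 2)).congr (.of_forall fun ω => ?_)
    simp only [hU]
    rw [mul_pow, ← Real.exp_nat_mul]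
    congr 2
    push_cast
    ring
  have hUi : Integrable U P := hU2.integrable (by norm_num)
  have hIU : 0 ≤ ∫ ω, U ω ∂P := integral_nonneg hU0
  refine ⟨fun ω => U ω + ∫ ω', U ω' ∂P, hU2.add (memLp_const _),
    fun ω => add_nonneg (hU0 ω) hIU, fun σ hσ hσc => ?_⟩
  have hb : ∀ ω, |Real.exp (σ * Y ω) - 1| ≤ σ * U ω := fun ω => by
    refine (abs_exp_sub_one_le_mul_exp _).trans ?_
    rw [abs_mul, abs_of_pos hσ, mul_assoc]
    gcongr
    have h1 : |Y ω| ≤ 4 / c * Real.exp (c / 4 * |Y ω|) := by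
      have := Real.add_one_le_exp (c / 4 * |Y ω|)
      rw [div_mul_eq_mul_div, le_div_iff₀ hc]
      linarith
    calc |Y ω| * Real.exp (σ * |Y ω|)
        ≤ 4 / c * Real.exp (c / 4 * |Y ω|) * Real.exp (c / 4 * |Y ω|) := by gcongr
      _ = U ω := by
        rw [mul_assoc, ← Real.exp_add]
        simp only [hU]
        congr 2
        ring
  have hsub : Integrable (fun ω => Real.exp (σ * Y ω) - 1) P :=
    (hUi.const_mul σ).mono' (by fun_prop) (.of_forall fun ω => hb ω)
  have hei : Integrable (fun ω => Real.exp (σ * Y ω)) P :=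
    (hsub.add (integrable_const 1)).congr (.of_forall fun ω => by simp)
  have hM1 : mgf Y P σ - 1 = ∫ ω, (Real.exp (σ * Y ω) - 1) ∂P := by
    rw [integral_sub hei (integrable_const 1)]
    simp [mgf]
  -- Since `Y` is centred, `1 + x ≤ exp x` yields this; dividing by the moment generating function
  -- then only decreases the deviation.
  have hM : 1 ≤ mgf Y P σ := by
    have : ∫ ω, σ * Y ω ∂P ≤ ∫ ω, (Real.exp (σ * Y ω) - 1) ∂P :=
      integral_mono (hi.const_mul σ) hsub fun ω => by
        have := Real.add_one_le_exp (σ * Y ω)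
        simp only; linarith
    rw [integral_const_mul, h0, mul_zero] at this
    linarith
  have hMU : |mgf Y P σ - 1| ≤ σ * ∫ ω, U ω ∂P := by
    rw [hM1, ← integral_const_mul]
    exact norm_integral_le_of_norm_le (f := fun ω => Real.exp (σ * Y ω) - 1) (hUi.const_mul σ)
      (.of_forall hb)
  refine ⟨by linarith, ?_, fun ω => ?_⟩
  · rw [integral_div]
    exact div_self (show mgf Y P σ ≠ 0 by linarith)
  · rw [div_sub_one (by linarith), abs_div, abs_of_pos (show 0 < mgf Y P σ by linarith)]
    refine (div_le_self (abs_nonneg _) hM).trans ?_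
    rw [show Real.exp (σ * Y ω) - mgf Y P σ = (Real.exp (σ * Y ω) - 1) - (mgf Y P σ - 1) by ring,
      mul_add]
    exact (abs_sub _ _).trans (add_le_add (hb ω) hMU)

/-- On the relevant scale, the new asset is an affine function of the old one with slope `σ /
volatility κ P X`, and standard deviations scale accordingly. In the log-normal case the shift is
minus the logarithm of the normalizing constant. -/
theorem volatility_eq_of_scale_eq {κ : VolKind} (hX : Measurable X) {V : Ω → Fin n → ℝ} {σ : ℝ}
    (hσ : 0 ≤ σ) (hv : 0 < volatility κ P X) {c : Fin n → ℝ}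
    (h : ∀ ω i, κ.scale (V ω i) = c i + σ * normalized κ P X ω i) :
    volatility κ P V = σ := by
  have hvar : ∀ i, √(Var[fun ω => κ.scale (V ω i); P]) =
      σ / volatility κ P X * √(Var[fun ω => κ.scale (X ω i); P]) := fun i => by
    have hm : Measurable fun ω => κ.scale (X ω i) := κ.measurable_scale.comp (by fun_prop)
    set b := c i - σ / volatility κ P X * ∫ ω', κ.scale (X ω' i) ∂P
    have h1 : (fun ω => κ.scale (V ω i)) = fun ω => b + σ / volatility κ P X * κ.scale (X ω i) := by
      funext ω
      rw [h]
      simp only [normalized, b]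
      ring
    rw [h1, variance_const_add (hm.const_mul _).aestronglyMeasurable, variance_const_mul,
      Real.sqrt_mul (sq_nonneg _), Real.sqrt_sq (by positivity)]
  rw [volatility, iSup_congr hvar, ← Real.mul_iSup_of_nonneg (by positivity)]
  exact div_mul_cancel₀ _ hv.ne'

/-- What the expansion of the value-at-risk needs to know about the assets with volatility `σ`. -/
structure AssetBound (κ : VolKind) (P : Measure Ω) (X : Ω → Fin n → ℝ) (Z : Ω → ℝ) (σ : ℝ) :
    Prop where
  volatility_eq : 0 < volatility κ P X → volatility κ P (assetFamily κ P X σ) = σ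
  pos : ∀ᵐ ω ∂P, ∀ i, 0 < assetFamily κ P X σ ω i
  mean : ∀ i, ∫ ω, assetFamily κ P X σ ω i ∂P = 1
  bound : ∀ ω i, |assetFamily κ P X σ ω i - 1| ≤ σ * Z ω

theorem StandingAssumptions.exists_assetBound_normal (h : StandingAssumptions P X L fL)
    (h2 : ∀ i, MemLp (fun ω => X ω i) 2 P) :
    ∃ Z : Ω → ℝ, MemLp Z 2 P ∧ ∀ᶠ σ in 𝓝[>] (0 : ℝ), AssetBound .normal P X Z σ := by
  set v := volatility .normal P X with hv
  have hv0 : 0 ≤ v := volatility_nonneg _ _ _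
  have hY : ∀ ω i, normalized .normal P X ω i = (X ω i - 1) / v := fun ω i => by
    rw [normalized, ← hv]
    simp only [VolKind.scale, h.asset_mean]
  have hYL : ∀ i, MemLp (fun ω => normalized .normal P X ω i) 2 P := fun i => by
    simp_rw [hY, div_eq_mul_inv]
    exact ((h2 i).sub (memLp_const 1)).mul_const v⁻¹
  refine ⟨fun ω => ∑ i, |normalized .normal P X ω i|,
    memLp_finsetSum _ fun i _ => (hYL i).abs, ?_⟩
  -- For `σ < v` the new asset is a convex combination of 1 and `X`, hence positive. If `v = 0`,
  -- division by zero makes the normalized asset vanish and any positive bound on σ will do.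
  have hσ0 : 0 < (if 0 < v then v else 1) := by split_ifs <;> simp_all
  filter_upwards [Ioo_mem_nhdsGT hσ0] with σ hσ
  refine ⟨fun hvp => volatility_eq_of_scale_eq h.measurable_asset hσ.1.le hvp (c := 1)
    fun ω i => rfl, ?_, fun i => ?_, fun ω i => ?_⟩
  · filter_upwards [h.asset_pos] with ω hω i
    simp only [assetFamily, hY]
    rcases hv0.eq_or_lt with hv' | hv'
    · rw [← hv']; simp
    · have h3 : σ < v := by simpa [hv'] using hσ.2
      have h4 := hω i
      rw [show 1 + σ * ((X ω i - 1) / v) = ((v - σ) + σ * X ω i) / v by field_simp; ring]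
      exact div_pos (add_pos (by linarith) (mul_pos hσ.1 h4)) hv'
  · simp only [assetFamily, hY]
    have hi : Integrable (fun ω => σ * ((X ω i - 1) / v)) P :=
      (((h.integrable_asset i).sub (integrable_const 1)).div_const v).const_mul σ
    rw [integral_add (integrable_const 1) hi, integral_const_mul, integral_div,
      integral_sub (h.integrable_asset i) (integrable_const 1), h.asset_mean]
    simp
  · simp only [assetFamily, add_sub_cancel_left, abs_mul, abs_of_pos hσ.1]
    have := hσ.1.le
    gcongr
    exact Finset.single_le_sum (f := fun i => |normalized .normal P X ω i|)
      (fun _ _ => abs_nonneg _) (Finset.mem_univ i)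

theorem abs_log_le_add_inv {x : ℝ} (hx : 0 < x) : |Real.log x| ≤ x + x⁻¹ := by
  have h1 := Real.log_le_sub_one_of_pos hx
  have h2 := Real.log_le_sub_one_of_pos (inv_pos.2 hx)
  have h3 := inv_pos.2 hx
  rw [Real.log_inv] at h2
  rw [abs_le]
  constructor <;> linarith

theorem StandingAssumptions.exists_assetBound_logNormal (h : StandingAssumptions P X L fL) :
    ∃ Z : Ω → ℝ, MemLp Z 2 P ∧ ∀ᶠ σ in 𝓝[>] (0 : ℝ), AssetBound .logNormal P X Z σ := by
  set v := volatility .logNormal P X with hv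
  have hv0 : 0 ≤ v := volatility_nonneg _ _ _
  -- With `c = v`, the product `c * |Y i ω|` is `|log X - E[log X]|`, whose exponential is at most a
  -- combination of `X` and its inverse, both integrable. If `v = 0` then `Y` vanishes and `c` is
  -- arbitrary.
  set c : ℝ := if 0 < v then v else 1 with hc
  have hc0 : 0 < c := by rw [hc]; split_ifs <;> simp_all
  set Y : Fin n → Ω → ℝ := fun i ω => normalized .logNormal P X ω i with hYdef
  have hX := h.measurable_asset
  have hXi : ∀ i, Measurable fun ω => X ω i := fun i => by fun_prop
  have hlogi : ∀ i, Integrable (fun ω => Real.log (X ω i)) P := fun i => by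
    refine ((h.integrable_asset i).add (h.integrable_asset_inv i)).mono'
      (Real.measurable_log.comp (hXi i)).aestronglyMeasurable ?_
    filter_upwards [h.asset_pos] with ω hω
    exact abs_log_le_add_inv (hω i)
  have hY : ∀ i ω, Y i ω = (Real.log (X ω i) - ∫ ω', Real.log (X ω' i) ∂P) / v := fun i ω => rfl
  have hYm : ∀ i, Measurable (Y i) := fun i =>
    ((Real.measurable_log.comp (hXi i)).sub_const _).div_const _
  have hYi : ∀ i, Integrable (Y i) P := fun i =>
    ((hlogi i).sub (integrable_const _)).div_const _
  have hY0 : ∀ i, ∫ ω, Y i ω ∂P = 0 := fun i => by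
    simp_rw [hY]
    rw [integral_div, integral_sub (hlogi i) (integrable_const _)]
    simp
  have hexp : ∀ i, Integrable (fun ω => Real.exp (c * |Y i ω|)) P := fun i => by
    rcases hv0.eq_or_lt with hv' | hv'
    · have : ∀ ω, Y i ω = 0 := fun ω => by rw [hY, ← hv', div_zero]
      simp [this]
    set m := ∫ ω', Real.log (X ω' i) ∂P with hm
    have hcv : c = v := by rw [hc, if_pos hv']
    refine (((h.integrable_asset i).mul_const (Real.exp (-m))).add
      ((h.integrable_asset_inv i).mul_const (Real.exp m))).mono'
      (Real.measurable_exp.comp ((hYm i).abs.const_mul c)).aestronglyMeasurable ?_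
    filter_upwards [h.asset_pos] with ω hω
    have h1 : c * |Y i ω| = |Real.log (X ω i) - m| := by
      rw [hY, abs_div, abs_of_pos hv', hcv]
      field_simp
      rfl
    have h2 : X ω i * Real.exp (-m) = Real.exp (Real.log (X ω i) - m) := by
      rw [sub_eq_add_neg, Real.exp_add, Real.exp_log (hω i)]
    have h3 : (X ω i)⁻¹ * Real.exp m = Real.exp (-(Real.log (X ω i) - m)) := by
      rw [neg_sub, sub_eq_add_neg, Real.exp_add, Real.exp_neg, Real.exp_log (hω i), mul_comm]
    rw [Real.norm_of_nonneg (Real.exp_pos _).le, Pi.add_apply, h1, h2, h3]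
    rcases abs_cases (Real.log (X ω i) - m) with ⟨h4, -⟩ | ⟨h4, -⟩ <;> rw [h4]
    · linarith [Real.exp_pos (-(Real.log (X ω i) - m))]
    · linarith [Real.exp_pos (Real.log (X ω i) - m)]
  choose Z hZ2 hZ0 hZ using fun i =>
    exists_abs_exp_div_mgf_sub_one_le (hYm i) (hYi i) (hY0 i) hc0 (hexp i)
  refine ⟨fun ω => ∑ i, Z i ω, memLp_finsetSum _ fun i _ => hZ2 i, ?_⟩
  filter_upwards [Ioo_mem_nhdsGT (show 0 < c / 4 by positivity)] with σ hσ
  have hM : ∀ i, 0 < mgf (Y i) P σ := fun i => (hZ i σ hσ.1 hσ.2.le).1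
  refine ⟨fun hvp => volatility_eq_of_scale_eq h.measurable_asset hσ.1.le hvp
    (c := fun i => -Real.log (mgf (Y i) P σ)) fun ω i => ?_, .of_forall fun ω i => ?_,
    fun i => (hZ i σ hσ.1 hσ.2.le).2.1, fun ω i => ?_⟩
  · simp only [assetFamily, VolKind.scale]
    rw [Real.log_div (Real.exp_pos _).ne' (hM i).ne', Real.log_exp]
    ring
  · exact div_pos (Real.exp_pos _) (hM i)
  · refine ((hZ i σ hσ.1 hσ.2.le).2.2 ω).trans ?_
    have := hσ.1.le
    gcongr
    exact Finset.single_le_sum (f := fun i => Z i ω) (fun j _ => hZ0 j ω) (Finset.mem_univ i)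

theorem StandingAssumptions.exists_assetBound (h : StandingAssumptions P X L fL) (κ : VolKind)
    (hκ : κ = VolKind.normal → ∀ i, MemLp (fun ω => X ω i) 2 P) :
    ∃ Z : Ω → ℝ, MemLp Z 2 P ∧ ∀ᶠ σ in 𝓝[>] (0 : ℝ), AssetBound κ P X Z σ := by
  cases κ
  · exact h.exists_assetBound_normal (hκ rfl)
  · exact h.exists_assetBound_logNormal

theorem AssetBound.memLp {κ : VolKind} {Z : Ω → ℝ} {σ : ℝ} (h : AssetBound κ P X Z σ)
    (hX : Measurable X) (hZ : MemLp Z 2 P) (i : Fin n) :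
    MemLp (fun ω => assetFamily κ P X σ ω i) 2 P := by
  have hm : Measurable fun ω => assetFamily κ P X σ ω i :=
    (measurable_pi_apply i).comp (measurable_assetFamily hX κ σ)
  have h1 : MemLp (fun ω => assetFamily κ P X σ ω i - 1) 2 P :=
    (hZ.const_mul σ).mono' (hm.sub_const 1).aestronglyMeasurable (.of_forall fun ω => h.bound ω i)
  exact (h1.add (memLp_const 1)).ae_eq (.of_forall fun ω => by simp)

end

/-! ### Averaging over the assets and inverting the loss probability -/

noncomputable section

variable {Ω : Type*} [MeasurableSpace Ω] {P : Measure Ω} {n : ℕ} {X L : Ω → Fin n → ℝ} {fL : (Fin n → ℝ) → ℝ}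

theorem measurableSet_loss (φ : Fin n → ℝ) (m : ℝ) :
    MeasurableSet {z : (Fin n → ℝ) × (Fin n → ℝ) | m < 1 ⬝ᵥ z.2 + (z.1 - 1) ⬝ᵥ (z.2 - φ)} := by
  simp only [dotProduct]
  exact measurableSet_lt measurable_const (by fun_prop)

/-- Seen as the measure of a slice of a measurable set in the product space, the conditional loss
probability is measurable in the assets and fits Fubini's theorem. -/
theorem StandingAssumptions.lossProb_eq (h : StandingAssumptions P X L fL) (hf : Measurable fL)
    (φ v : Fin n → ℝ) (m : ℝ) :
    lossProb fL φ (v - 1) m = (P.map L).real (Prod.mk v ⁻¹'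
      {z : (Fin n → ℝ) × (Fin n → ℝ) | m < 1 ⬝ᵥ z.2 + (z.1 - 1) ⬝ᵥ (z.2 - φ)}) := by
  have hs := measurable_prodMk_left (x := v) (measurableSet_loss φ m)
  rw [map_measureReal_apply h.measurable_claim hs]
  have := h.setIntegral_comp_claim hf hs (g := fun _ => 1) measurable_const
  simp only [setIntegral_const, smul_eq_mul, mul_one, one_mul] at this
  rw [this]
  rfl

theorem AssetBound.covMat_apply {κ : VolKind} {Z : Ω → ℝ} {σ : ℝ} (h : AssetBound κ P X Z σ)
    (i j : Fin n) : covMat P (assetFamily κ P X σ) i j =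
      ∫ ω, (assetFamily κ P X σ ω i - 1) * (assetFamily κ P X σ ω j - 1) ∂P := by
  simp only [covMat, Matrix.of_apply, covariance, h.mean]

theorem AssetBound.norm_sub_one_le {κ : VolKind} {Z : Ω → ℝ} {σ : ℝ} (h : AssetBound κ P X Z σ)
    (i₀ : Fin n) (ω : Ω) : ‖assetFamily κ P X σ ω - 1‖ ≤ σ * Z ω :=
  (pi_norm_le_iff_of_nonneg ((abs_nonneg _).trans (h.bound ω i₀))).2 (h.bound ω)

theorem AssetBound.abs_covMat_le {κ : VolKind} {Z : Ω → ℝ} {σ : ℝ} (h : AssetBound κ P X Z σ)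
    (hZ : MemLp Z 2 P) (i j : Fin n) :
    |covMat P (assetFamily κ P X σ) i j| ≤ (∫ ω, Z ω ^ 2 ∂P) * σ ^ 2 := by
  rw [h.covMat_apply, ← integral_mul_const]
  refine norm_integral_le_of_norm_le (f := fun ω => (assetFamily κ P X σ ω i - 1) *
    (assetFamily κ P X σ ω j - 1)) (hZ.integrable_sq.mul_const _) (.of_forall fun ω => ?_)
  rw [norm_mul, Real.norm_eq_abs, Real.norm_eq_abs]
  have hi := h.bound ω i
  have hj := h.bound ω j
  calc |assetFamily κ P X σ ω i - 1| * |assetFamily κ P X σ ω j - 1|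
      ≤ (σ * Z ω) * (σ * Z ω) :=
        mul_le_mul hi hj (abs_nonneg _) ((abs_nonneg _).trans hi)
    _ = Z ω ^ 2 * σ ^ 2 := by ring

variable [IsProbabilityMeasure P]

theorem StandingAssumptions.measurable_lossProb (h : StandingAssumptions P X L fL)
    (hf : Measurable fL) (φ : Fin n → ℝ) (m : ℝ) :
    Measurable fun v => lossProb fL φ (v - 1) m := by
  have : IsProbabilityMeasure (P.map L) :=
    Measure.isProbabilityMeasure_map h.measurable_claim.aemeasurable
  simp_rw [h.lossProb_eq hf]
  exact (measurable_measure_prodMk_left (measurableSet_loss φ m)).ennreal_toReal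

theorem StandingAssumptions.abs_lossProb_le_one (h : StandingAssumptions P X L fL)
    (hf : Measurable fL) (φ v : Fin n → ℝ) (m : ℝ) : |lossProb fL φ (v - 1) m| ≤ 1 := by
  have : IsProbabilityMeasure (P.map L) :=
    Measure.isProbabilityMeasure_map h.measurable_claim.aemeasurable
  rw [h.lossProb_eq hf, abs_of_nonneg measureReal_nonneg]
  exact measureReal_le_one

/-- Conditioning the probability of a loss on the assets. -/
theorem StandingAssumptions.measureReal_surplus (h : StandingAssumptions P X L fL)
    (hf : Measurable fL) {g : (Fin n → ℝ) → Fin n → ℝ} (hg : Measurable g) (φ : Fin n → ℝ) (m : ℝ) :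
    P.real {ω | surplus (fun ω => g (X ω)) L φ ω + m < 0} =
      ∫ ω, lossProb fL φ (g (X ω) - 1) m ∂P := by
  have hL := h.measurable_claim
  have hV : Measurable fun ω => g (X ω) := hg.comp h.measurable_asset
  have : IsProbabilityMeasure (P.map L) := Measure.isProbabilityMeasure_map hL.aemeasurable
  have : IsProbabilityMeasure (P.map fun ω => g (X ω)) :=
    Measure.isProbabilityMeasure_map hV.aemeasurable
  have hind : IndepFun (fun ω => g (X ω)) L P := h.indep.comp hg measurable_id
  have hmap := (indepFun_iff_map_prod_eq_prod_map_map hV.aemeasurable hL.aemeasurable).1 hind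
  have hS := measurableSet_loss φ m
  set S := {z : (Fin n → ℝ) × (Fin n → ℝ) | m < 1 ⬝ᵥ z.2 + (z.1 - 1) ⬝ᵥ (z.2 - φ)} with hSdef
  have hset : {ω | surplus (fun ω => g (X ω)) L φ ω + m < 0} = (fun ω => (g (X ω), L ω)) ⁻¹' S := by
    ext ω
    simp only [hSdef, surplus, Set.mem_ofPred_eq, Set.mem_preimage, sub_dotProduct, dotProduct_sub]
    constructor <;> intro h <;> linarith
  rw [hset, ← map_measureReal_apply (hV.prodMk hL) hS, hmap, measureReal_def,
    Measure.prod_apply hS, ← integral_toReal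
      (measurable_measure_prodMk_left hS).aemeasurable (.of_forall fun _ => measure_lt_top _ _),
    integral_map hV.aemeasurable
      (measurable_measure_prodMk_left hS).ennreal_toReal.aestronglyMeasurable]
  exact integral_congr_ae (.of_forall fun ω => (h.lossProb_eq hf φ _ m).symm)

theorem AssetBound.memLp_sub_one {κ : VolKind} {Z : Ω → ℝ} {σ : ℝ} (h : AssetBound κ P X Z σ)
    (hX : Measurable X) (hZ : MemLp Z 2 P) (i : Fin n) :
    MemLp (fun ω => assetFamily κ P X σ ω i - 1) 2 P :=
  (h.memLp hX hZ i).sub (memLp_const 1)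

theorem StandingAssumptions.measurable_lossRem (h : StandingAssumptions P X L fL)
    (hf : Measurable fL) (i₀ : Fin n) (φ : Fin n → ℝ) (m : ℝ) :
    Measurable fun v => lossRem fL i₀ φ (v - 1) m := by
  have := h.measurable_lossProb hf φ m
  simp only [lossRem, Pi.sub_apply]
  fun_prop

/-- The probability of a loss, expanded to second order. -/
theorem StandingAssumptions.measureReal_surplus_eq (h : StandingAssumptions P X L fL)
    (hfL : RegularDensity fL) {κ : VolKind} {Z : Ω → ℝ} {σ : ℝ} (hb : AssetBound κ P X Z σ)
    (hZ : MemLp Z 2 P) (i₀ : Fin n) (φ : Fin n → ℝ) (m : ℝ) :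
    P.real {ω | surplus (assetFamily κ P X σ) L φ ω + m < 0} =
      tailIntegral fL m + 1 / 2 * iteratedDeriv 2
        (quadK P L (covMat P (assetFamily κ P X σ)) fun ω => φ - L ω) m
      + ∫ ω, lossRem fL i₀ φ (assetFamily κ P X σ ω - 1) m ∂P := by
  have hf := hfL.measurable
  have hX := h.measurable_asset
  set V := assetFamily κ P X σ with hV
  obtain ⟨g, hg, hVg⟩ := exists_measurable_assetFamily (P := P) (X := X) κ σ
  have hVm : Measurable V := measurable_assetFamily hX κ σ
  have h1 : P.real {ω | surplus V L φ ω + m < 0} = ∫ ω, lossProb fL φ (V ω - 1) m ∂P := by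
    rw [show V = fun ω => g (X ω) from funext hVg]
    exact h.measureReal_surplus hf hg φ m
  have hWi : ∀ i, Integrable (fun ω => V ω i - 1) P := fun i =>
    (hb.memLp_sub_one hX hZ i).integrable (by norm_num)
  -- Mean one removes the first-order term; this is why the expansion starts at order σ².
  have hW0 : ∀ i, ∫ ω, (V ω i - 1) ∂P = 0 := fun i => by
    rw [integral_sub ((hb.memLp hX hZ i).integrable (by norm_num)) (integrable_const 1), hb.mean]
    simp
  have hWW : ∀ x : Fin n × Fin n, Integrable (fun ω => (V ω x.1 - 1) * (V ω x.2 - 1)) P :=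
    fun x => (hb.memLp_sub_one hX hZ x.1).integrable_mul (hb.memLp_sub_one hX hZ x.2)
  have hcov : ∀ x : Fin n × Fin n, ∫ ω, (V ω x.1 - 1) * (V ω x.2 - 1) ∂P = covMat P V x.1 x.2 :=
    fun x => (hb.covMat_apply _ _).symm
  set A : Fin n → ℝ := fun i => tailIntegral (dirDeriv (Pi.single i₀ 1) (moment₁ fL φ i)) m
  set B : Fin n × Fin n → ℝ := fun x => tailIntegral
    (dirDeriv (Pi.single i₀ 1) (dirDeriv (Pi.single i₀ 1) (moment₂ fL φ x))) m
  have hP : Integrable (fun ω => lossProb fL φ (V ω - 1) m) P :=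
    (integrable_const (1 : ℝ)).mono' ((h.measurable_lossProb hf φ m).comp hVm).aestronglyMeasurable
      (.of_forall fun ω => h.abs_lossProb_le_one hf φ (V ω) m)
  have hA : Integrable (fun ω => ∑ i, (V ω i - 1) * A i) P :=
    integrable_finsetSum _ fun i _ => (hWi i).mul_const _
  have hB : Integrable (fun ω => 1 / 2 * ∑ x : Fin n × Fin n, (V ω x.1 - 1) * (V ω x.2 - 1) * B x)
      P := (integrable_finsetSum _ fun x _ => (hWW x).mul_const _).const_mul _
  have hrem : ∫ ω, lossRem fL i₀ φ (V ω - 1) m ∂P = (∫ ω, lossProb fL φ (V ω - 1) m ∂P)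
      - tailIntegral fL m + 0
      - 1 / 2 * ∑ x : Fin n × Fin n, covMat P V x.1 x.2 * B x := by
    have hPt : Integrable (fun ω => lossProb fL φ (V ω - 1) m - tailIntegral fL m) P :=
      hP.sub (integrable_const _)
    have hPA : Integrable (fun ω => lossProb fL φ (V ω - 1) m - tailIntegral fL m +
      ∑ i, (V ω i - 1) * A i) P := hPt.add hA
    change ∫ ω, (lossProb fL φ (V ω - 1) m - tailIntegral fL m + ∑ i, (V ω i - 1) * A i -
      1 / 2 * ∑ x : Fin n × Fin n, (V ω x.1 - 1) * (V ω x.2 - 1) * B x) ∂P = _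
    rw [integral_sub hPA hB, integral_add hPt hA, integral_sub hP (integrable_const _),
      integral_finsetSum _ fun i _ => (hWi i).mul_const _, integral_const_mul,
      integral_finsetSum _ fun x _ => (hWW x).mul_const _]
    simp_rw [integral_mul_const, hW0, hcov]
    simp
  rw [h1, hrem, h.iteratedDeriv_quadK hfL i₀]
  simp_rw [(hfL.integrableC2_moment₂ φ _).iteratedDeriv_tailIntegral i₀]
  ring

/-- Dominated convergence with `‖X_σ - 1‖ ≤ σ Z`: the global quadratic bound yields the majorant
`|C| * Z ω ^ 2`, and for fixed ω the local bound yields the pointwise limit, since `σ * Z ω → 0`.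
The level is a free variable near `q` because the inversion evaluates it at points moving with σ. -/
theorem StandingAssumptions.tendsto_integral_lossRem (h : StandingAssumptions P X L fL)
    (hfL : RegularDensity fL) {κ : VolKind} {Z : Ω → ℝ} (hZ : MemLp Z 2 P)
    (hb : ∀ᶠ σ in 𝓝[>] (0 : ℝ), AssetBound κ P X Z σ) (i₀ : Fin n) (φ : Fin n → ℝ) (q : ℝ) :
    Tendsto (fun z : ℝ × ℝ => (z.1 ^ 2)⁻¹ *
      ∫ ω, lossRem fL i₀ φ (assetFamily κ P X z.1 ω - 1) z.2 ∂P) (𝓝[>] 0 ×ˢ 𝓝 q) (𝓝 0) := by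
  obtain ⟨C, δ, hδ, hC⟩ := hfL.exists_abs_lossRem_le_const_mul i₀ φ q
  have hm : ∀ {δ : ℝ}, 0 < δ → ∀ᶠ z : ℝ × ℝ in 𝓝[>] 0 ×ˢ 𝓝 q, |z.2 - q| < δ := fun hδ =>
    tendsto_snd.eventually (eventually_abs_sub_lt q hδ)
  have hev : ∀ᶠ z : ℝ × ℝ in 𝓝[>] 0 ×ˢ 𝓝 q, AssetBound κ P X Z z.1 ∧ 0 < z.1 :=
    tendsto_fst.eventually (hb.and self_mem_nhdsWithin)
  simp_rw [← integral_const_mul]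
  suffices hlim : Tendsto (fun z : ℝ × ℝ => ∫ ω, (z.1 ^ 2)⁻¹ *
      lossRem fL i₀ φ (assetFamily κ P X z.1 ω - 1) z.2 ∂P) (𝓝[>] 0 ×ˢ 𝓝 q)
      (𝓝 (∫ _ : Ω, (0 : ℝ) ∂P)) by
    rwa [integral_zero] at hlim
  refine tendsto_integral_filter_of_dominated_convergence (fun ω => |C| * Z ω ^ 2)
    (.of_forall fun z => ?_) ?_ (hZ.integrable_sq.const_mul _) (.of_forall fun ω => ?_)
  · exact (((h.measurable_lossRem hfL.measurable i₀ φ z.2).comp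
      (measurable_assetFamily h.measurable_asset κ z.1)).const_mul _).aestronglyMeasurable
  · filter_upwards [hev, hm hδ] with z hz hzm
    refine .of_forall fun ω => ?_
    have hz2 : 0 < z.1 ^ 2 := pow_pos hz.2 2
    rw [norm_mul, Real.norm_of_nonneg (by positivity), Real.norm_eq_abs, inv_mul_le_iff₀ hz2]
    calc _ ≤ C * ‖assetFamily κ P X z.1 ω - 1‖ ^ 2 := hC _ _ hzm
      _ ≤ |C| * (z.1 * Z ω) ^ 2 := by
        gcongr
        · exact le_abs_self C
        · exact hz.1.norm_sub_one_le i₀ ω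
      _ = _ := by ring
  · rw [Metric.tendsto_nhds]
    intro ε hε
    obtain ⟨δ', hδ', hR⟩ := hfL.exists_abs_lossRem_le i₀ φ q
      (show 0 < ε / (Z ω ^ 2 + 1) by positivity)
    have hσ : ∀ᶠ z : ℝ × ℝ in 𝓝[>] 0 ×ˢ 𝓝 q, z.1 * Z ω < δ' := by
      have h1 : Tendsto (fun σ : ℝ => σ * Z ω) (𝓝[>] 0) (𝓝 0) := by
        have h2 : Continuous fun σ : ℝ => σ * Z ω := by fun_prop
        simpa using (h2.tendsto 0).mono_left nhdsWithin_le_nhds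
      exact tendsto_fst.eventually (h1.eventually (gt_mem_nhds hδ'))
    filter_upwards [hev, hm hδ', hσ] with z hz hzm hzσ
    have hz2 : 0 < z.1 ^ 2 := pow_pos hz.2 2
    have hz1 := hz.2.ne'
    have hn := hz.1.norm_sub_one_le i₀ ω
    rw [dist_zero_right, norm_mul, Real.norm_of_nonneg (by positivity), Real.norm_eq_abs]
    calc (z.1 ^ 2)⁻¹ * |lossRem fL i₀ φ (assetFamily κ P X z.1 ω - 1) z.2|
        ≤ (z.1 ^ 2)⁻¹ * (ε / (Z ω ^ 2 + 1) * (z.1 * Z ω) ^ 2) := by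
          gcongr
          exact (hR _ _ (hn.trans_lt hzσ) hzm).trans (by gcongr)
      _ = ε * (Z ω ^ 2 / (Z ω ^ 2 + 1)) := by field_simp
      _ < ε * 1 := by
          gcongr
          rw [div_lt_one (by positivity)]
          linarith
      _ = ε := mul_one ε

/-- Second-order expansion of a generalized inverse `inf {m | p σ m ≤ α}`, when
`p σ m = G m + k σ m / 2 + o(σ²)` near `σ = 0` and the `α`-quantile `q` of `G`. -/
theorem isLittleO_sInf_sub {p k : ℝ → ℝ → ℝ} {G : ℝ → ℝ} {q α f : ℝ} (hf : 0 < f)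
    (hp : ∀ σ, Antitone (p σ)) (hG : HasDerivAt G (-f) q) (hq : G q = α) {M : ℝ}
    (hkq : ∀ᶠ σ in 𝓝[>] (0 : ℝ), |k σ q| ≤ M * σ ^ 2)
    (hk : Tendsto (fun z : ℝ × ℝ => (z.1 ^ 2)⁻¹ * (k z.1 z.2 - k z.1 q)) (𝓝[>] 0 ×ˢ 𝓝 q) (𝓝 0))
    (hpk : Tendsto (fun z : ℝ × ℝ => (z.1 ^ 2)⁻¹ * (p z.1 z.2 - (G z.2 + 1 / 2 * k z.1 z.2)))
      (𝓝[>] 0 ×ˢ 𝓝 q) (𝓝 0)) :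
    (fun σ => sInf {m | p σ m ≤ α} - (q + 1 / 2 * f⁻¹ * k σ q)) =o[𝓝[>] 0] fun σ : ℝ => σ ^ 2 := by
  have hpos : ∀ᶠ σ in 𝓝[>] (0 : ℝ), 0 < σ := self_mem_nhdsWithin
  have hσ0 : Tendsto (fun σ : ℝ => σ ^ 2) (𝓝[>] 0) (𝓝 0) := by
    have h2 : Continuous fun σ : ℝ => σ ^ 2 := by fun_prop
    simpa using (h2.tendsto 0).mono_left nhdsWithin_le_nhds
  -- At the predicted level shifted by `η * σ ^ 2`, the slope `-f` of `G` turns the correction `k /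
  -- (2 f)` into `-k / 2`, which cancels the perturbation. Only `-f * η` survives at order `σ ^ 2`.
  have key : ∀ η : ℝ, Tendsto (fun σ => (σ ^ 2)⁻¹ *
      (p σ (q + (1 / 2 * f⁻¹ * k σ q + η * σ ^ 2)) - α)) (𝓝[>] 0) (𝓝 (-f * η)) := by
    intro η
    set d : ℝ → ℝ := fun σ => 1 / 2 * f⁻¹ * k σ q + η * σ ^ 2 with hd
    have hdO : d =O[𝓝[>] 0] fun σ : ℝ => σ ^ 2 := by
      refine IsBigO.add (IsBigO.const_mul_left ?_ _) ((isBigO_refl _ _).const_mul_left _)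
      refine IsBigO.of_bound M (hkq.mono fun σ hσ => ?_)
      rwa [Real.norm_eq_abs, Real.norm_of_nonneg (sq_nonneg σ)]
    have hd0 : Tendsto d (𝓝[>] 0) (𝓝 0) := hdO.trans_tendsto hσ0
    have hm : Tendsto (fun σ => (σ, q + d σ)) (𝓝[>] 0) (𝓝[>] 0 ×ˢ 𝓝 q) :=
      tendsto_id.prodMk (by simpa using hd0.const_add q)
    have t1 := hpk.comp hm
    have t2 := hk.comp hm
    have t3 : Tendsto (fun σ => (σ ^ 2)⁻¹ * (G (q + d σ) - G q + f * d σ)) (𝓝[>] 0) (𝓝 0) := by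
      have h1 := ((hasDerivAt_iff_isLittleO_nhds_zero.1 hG).comp_tendsto hd0).trans_isBigO hdO
      refine h1.tendsto_div_nhds_zero.congr fun σ => ?_
      simp only [Function.comp_apply, smul_eq_mul]
      ring
    have t4 := (t1.add ((t2.const_mul (1 / 2)).add t3)).add_const (-f * η)
    simp only [mul_zero, add_zero, zero_add] at t4
    refine t4.congr' (hpos.mono fun σ hσ => ?_)
    simp only [Function.comp_apply, hd, hq]
    have : σ ^ 2 ≠ 0 := by positivity
    field_simp
    ring
  rw [isLittleO_iff]
  intro ε hε
  -- The choices `η = ε` and `η = -ε` put `p σ` strictly below and strictly above `α`; monotonicity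
  -- traps the infimum between these two levels.
  filter_upwards [hpos, (key ε).eventually (gt_mem_nhds (show -f * ε < 0 by nlinarith)),
    (key (-ε)).eventually (lt_mem_nhds (show 0 < -f * -ε by nlinarith))] with σ hσ h1 h2
  have hσ2 : 0 < (σ ^ 2)⁻¹ := by positivity
  have h1' : p σ (q + (1 / 2 * f⁻¹ * k σ q + ε * σ ^ 2)) < α := by
    by_contra hcon
    exact absurd h1 (not_lt.2 (mul_nonneg hσ2.le (by linarith)))
  have h2' : α < p σ (q + (1 / 2 * f⁻¹ * k σ q + -ε * σ ^ 2)) := by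
    by_contra hcon
    exact absurd h2 (not_lt.2 (mul_nonpos_of_nonneg_of_nonpos hσ2.le (by linarith)))
  have hlow : ∀ m ∈ {m | p σ m ≤ α}, q + (1 / 2 * f⁻¹ * k σ q + -ε * σ ^ 2) ≤ m := fun m hm => by
    by_contra hcon
    have h3 := hp σ (not_le.1 hcon).le
    have h4 : p σ m ≤ α := hm
    linarith
  have hup := csInf_le ⟨_, hlow⟩ (show _ ∈ {m | p σ m ≤ α} from h1'.le)
  have hlo := le_csInf ⟨_, (show _ ∈ {m | p σ m ≤ α} from h1'.le)⟩ hlow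
  rw [Real.norm_eq_abs, Real.norm_of_nonneg (sq_nonneg σ), abs_le]
  constructor <;> linarith

/-- The second-order expansion of the value-at-risk of the surplus. -/
theorem StandingAssumptions.isLittleO_valueAtRisk (h : StandingAssumptions P X L fL)
    (hfL : RegularDensity fL) (i₀ : Fin n) (κ : VolKind)
    (hκ : κ = VolKind.normal → ∀ i, MemLp (fun ω => X ω i) 2 P) {α : ℝ} (hα0 : 0 < α) (hα1 : α < 1)
    {q : ℝ} (hq : q = quantile P (totalClaim L) (1 - α)) (φ : Fin n → ℝ) :
    (fun σ : ℝ => valueAtRisk P α (surplus (assetFamily κ P X σ) L φ)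
      - secondOrderVaR P L (covMat P (assetFamily κ P X σ)) q φ)
      =o[𝓝[>] 0] fun σ : ℝ => σ ^ 2 := by
  obtain ⟨Z, hZ, hb⟩ := h.exists_assetBound κ hκ
  set B : Fin n × Fin n → ℝ → ℝ := fun x => iteratedDeriv 2 (tailIntegral (moment₂ fL φ x)) with hB
  have hBc : ∀ x, Continuous (B x) := fun x =>
    ((hfL.integrableC2_moment₂ φ x).contDiff_halfSpaceIntegral
      (dotCLM_one_single i₀)).continuous_iteratedDeriv 2 (by norm_num)
  have hpos : ∀ᶠ σ in 𝓝[>] (0 : ℝ), 0 < σ := self_mem_nhdsWithin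
  have hI : 0 ≤ ∫ ω, Z ω ^ 2 ∂P := integral_nonneg fun _ => sq_nonneg _
  refine isLittleO_sInf_sub (p := fun σ m =>
    P.real {ω | surplus (assetFamily κ P X σ) L φ ω + m < 0})
    (k := fun σ m => iteratedDeriv 2
      (quadK P L (covMat P (assetFamily κ P X σ)) fun ω => φ - L ω) m)
    (G := tailIntegral fL) (h.totalDensity_pos hfL i₀ q) (fun σ m m' hm => ?_)
    (h.hasDerivAt_tailIntegral hfL i₀ q) (hq ▸ h.tailIntegral_quantile hfL i₀ hα0 hα1)
    -- Each covariance is at most `E[Z ^ 2] * σ ^ 2`, and the functions `B x` are continuous and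
    -- independent of σ; both conditions on `k` follow.
    (M := (∫ ω, Z ω ^ 2 ∂P) * ∑ x, |B x q|) ?_ ?_ ?_
  · refine measureReal_mono fun ω hω => ?_
    have : surplus (assetFamily κ P X σ) L φ ω + m' < 0 := hω
    exact lt_of_le_of_lt (by linarith) this
  · filter_upwards [hb] with σ hσ
    rw [h.iteratedDeriv_quadK hfL i₀]
    refine (Finset.abs_sum_le_sum_abs _ _).trans ?_
    rw [mul_right_comm, Finset.mul_sum]
    refine Finset.sum_le_sum fun x _ => ?_
    rw [abs_mul]
    gcongr
    exact hσ.abs_covMat_le hZ x.1 x.2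
  · simp_rw [h.iteratedDeriv_quadK hfL i₀]
    have hz : Tendsto (fun z : ℝ × ℝ => (∫ ω, Z ω ^ 2 ∂P) * ∑ x, |B x z.2 - B x q|)
        (𝓝[>] 0 ×ˢ 𝓝 q) (𝓝 0) := by
      have hc : Continuous fun m => (∫ ω, Z ω ^ 2 ∂P) * ∑ x, |B x m - B x q| := by fun_prop
      have := hc.tendsto q
      simp only [sub_self, abs_zero, Finset.sum_const_zero, mul_zero] at this
      exact this.comp tendsto_snd
    refine squeeze_zero_norm' ?_ hz
    filter_upwards [tendsto_fst.eventually (hb.and hpos)] with z hz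
    have hz2 : 0 < z.1 ^ 2 := pow_pos hz.2 2
    rw [norm_mul, Real.norm_of_nonneg (by positivity), Real.norm_eq_abs, inv_mul_le_iff₀ hz2,
      ← Finset.sum_sub_distrib]
    refine (Finset.abs_sum_le_sum_abs _ _).trans ?_
    rw [← mul_assoc, Finset.mul_sum]
    refine Finset.sum_le_sum fun x _ => ?_
    rw [← mul_sub, abs_mul, mul_comm (z.1 ^ 2)]
    gcongr
    exact hz.1.abs_covMat_le hZ x.1 x.2
  · refine (h.tendsto_integral_lossRem hfL hZ hb i₀ φ q).congr' ?_
    filter_upwards [tendsto_fst.eventually hb] with z hz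
    rw [h.measureReal_surplus_eq hfL hz hZ i₀]
    ring

end

/-! ### The expansion as a quadratic function of the allocation -/

noncomputable section

section Quadratic

variable {n : ℕ} {A : Matrix (Fin n) (Fin n) ℝ}

theorem dotProduct_mulVec_eq_sum (v w : Fin n → ℝ) :
    v ⬝ᵥ (A *ᵥ w) = ∑ x : Fin n × Fin n, A x.1 x.2 * (v x.1 * w x.2) := by
  simp only [dotProduct, mulVec, ← Finset.univ_product_univ, Finset.sum_product, Finset.mul_sum]
  exact Finset.sum_congr rfl fun i _ => Finset.sum_congr rfl fun j _ => by ring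

theorem dotProduct_mulVec_comm_of_isSymm (hA : A.IsSymm) (v w : Fin n → ℝ) :
    v ⬝ᵥ (A *ᵥ w) = w ⬝ᵥ (A *ᵥ v) := by
  rw [dotProduct_mulVec, ← mulVec_transpose, hA.eq, dotProduct_comm]

variable {c b : ℝ} {φs : Fin n → ℝ} {V : (Fin n → ℝ) → ℝ}

theorem hasFDerivAt_zero_iff_of_eq_quadratic (hA : A.PosDef) (hb : b ≠ 0)
    (hV : ∀ φ, V φ = c + b * ((φ - φs) ⬝ᵥ (A *ᵥ (φ - φs)))) (φ : Fin n → ℝ) :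
    HasFDerivAt V (0 : (Fin n → ℝ) →L[ℝ] ℝ) φ ↔ φ = φs := by
  have hline : ∀ (w v : Fin n → ℝ), HasFDerivAt V (0 : (Fin n → ℝ) →L[ℝ] ℝ) w →
      HasDerivAt (fun t : ℝ => V (w + t • v)) 0 0 := fun w v hw => by
    have h1 : HasDerivAt (fun t : ℝ => w + t • v) v 0 := by
      simpa using ((hasDerivAt_id (0 : ℝ)).smul_const v).const_add w
    have h2 : HasFDerivAt V (0 : (Fin n → ℝ) →L[ℝ] ℝ) (w + (0 : ℝ) • v) := by simpa using hw
    exact (h2.comp_hasDerivAt (0 : ℝ) h1).congr_deriv (by simp)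
  constructor
  · intro h
    by_contra hne
    have hq := hA.dotProduct_mulVec_pos (sub_ne_zero.2 hne)
    rw [star_trivial] at hq
    -- The ray from `φs` through `φ` suffices: along it the function is `c + b (1 + t)² Q` with `Q >
    -- 0`, whose slope `2 b Q` at `t = 0` is nonzero.
    have h1 := hline φ (φ - φs) h
    have h2 : (fun t : ℝ => V (φ + t • (φ - φs))) = fun t : ℝ =>
        c + b * ((1 + t) ^ 2 * ((φ - φs) ⬝ᵥ (A *ᵥ (φ - φs)))) := by
      funext t
      rw [hV, show φ + t • (φ - φs) - φs = (1 + t) • (φ - φs) by module, mulVec_smul,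
        smul_dotProduct, dotProduct_smul, smul_eq_mul, smul_eq_mul]
      ring
    rw [h2] at h1
    have h3 : HasDerivAt (fun t : ℝ => c + b * ((1 + t) ^ 2 * ((φ - φs) ⬝ᵥ (A *ᵥ (φ - φs)))))
        (b * (2 * ((φ - φs) ⬝ᵥ (A *ᵥ (φ - φs))))) 0 := by
      have h4 : HasDerivAt (fun t : ℝ => (1 + t) ^ 2) 2 0 := by
        exact (((hasDerivAt_id (0 : ℝ)).const_add 1).pow 2).congr_deriv (by simp)
      exact ((h4.mul_const _).const_mul b).const_add c
    have := h1.unique h3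
    have hne' : b * (2 * ((φ - φs) ⬝ᵥ (A *ᵥ (φ - φs)))) ≠ 0 := by positivity
    exact hne' this.symm
  · rintro rfl
    have hd : Differentiable ℝ V := by
      rw [funext hV]
      simp_rw [dotProduct_mulVec_eq_sum, Pi.sub_apply]
      fun_prop
    have h0 := (hd φ).hasFDerivAt
    suffices hz : fderiv ℝ V φ = 0 by rwa [hz] at h0
    ext v
    have h1 : HasDerivAt (fun t : ℝ => φ + t • v) v 0 := by
      simpa using ((hasDerivAt_id (0 : ℝ)).smul_const v).const_add φ
    have h2 : HasFDerivAt V (fderiv ℝ V φ) (φ + (0 : ℝ) • v) := by simpa using h0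
    have h3 := h2.comp_hasDerivAt (0 : ℝ) h1
    have h4 : (V ∘ fun t : ℝ => φ + t • v) = fun t : ℝ => c + b * (t ^ 2 * (v ⬝ᵥ (A *ᵥ v))) := by
      funext t
      simp only [Function.comp_apply]
      rw [hV, add_sub_cancel_left, mulVec_smul, smul_dotProduct, dotProduct_smul, smul_eq_mul,
        smul_eq_mul]
      ring
    rw [h4] at h3
    have h5 : HasDerivAt (fun t : ℝ => c + b * (t ^ 2 * (v ⬝ᵥ (A *ᵥ v)))) 0 0 := by
      have h6 : HasDerivAt (fun t : ℝ => t ^ 2) 0 0 := by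
        simpa using hasDerivAt_pow 2 (0 : ℝ)
      simpa using ((h6.mul_const _).const_mul b).const_add c
    exact h3.unique h5

theorem lt_of_eq_quadratic (hA : A.PosDef) (hb : 0 < b)
    (hV : ∀ φ, V φ = c + b * ((φ - φs) ⬝ᵥ (A *ᵥ (φ - φs)))) {φ : Fin n → ℝ} (hφ : φ ≠ φs) :
    V φs < V φ := by
  have hq := hA.dotProduct_mulVec_pos (sub_ne_zero.2 hφ)
  rw [star_trivial] at hq
  rw [hV, hV φ, sub_self, zero_dotProduct]
  have := mul_pos hb hq
  linarith

theorem lt_of_eq_neg_quadratic (hA : A.PosDef) (hb : b < 0)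
    (hV : ∀ φ, V φ = c + b * ((φ - φs) ⬝ᵥ (A *ᵥ (φ - φs)))) {φ : Fin n → ℝ} (hφ : φ ≠ φs) :
    V φ < V φs := by
  have hq := hA.dotProduct_mulVec_pos (sub_ne_zero.2 hφ)
  rw [star_trivial] at hq
  rw [hV, hV φs, sub_self, zero_dotProduct]
  have := mul_neg_of_neg_of_pos hb hq
  linarith

theorem not_bddBelow_of_eq_neg_quadratic (i₀ : Fin n) (hA : A.PosDef) (hb : b < 0)
    (hV : ∀ φ, V φ = c + b * ((φ - φs) ⬝ᵥ (A *ᵥ (φ - φs)))) : ¬ BddBelow (Set.range V) := by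
  rintro ⟨B, hB⟩
  set v : Fin n → ℝ := Pi.single i₀ 1
  have hv : v ≠ 0 := fun h => by simpa [v] using congrFun h i₀
  have hq := hA.dotProduct_mulVec_pos hv
  rw [star_trivial] at hq
  have hlim : Tendsto (fun t : ℝ => c + b * (v ⬝ᵥ (A *ᵥ v)) * t ^ 2) atTop atBot :=
    tendsto_atBot_add_const_left _ _ ((tendsto_pow_atTop (by norm_num)).const_mul_atTop_of_neg
      (mul_neg_of_neg_of_pos hb hq))
  obtain ⟨t, ht⟩ := (hlim.eventually (eventually_lt_atBot B)).exists
  have h1 := hB ⟨φs + t • v, rfl⟩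
  rw [hV, add_sub_cancel_left, mulVec_smul, smul_dotProduct, dotProduct_smul, smul_eq_mul,
    smul_eq_mul] at h1
  linarith

end Quadratic

variable {Ω : Type*} [MeasurableSpace Ω] {P : Measure Ω} {n : ℕ} {X L : Ω → Fin n → ℝ}
  {fL : (Fin n → ℝ) → ℝ}

theorem isSymm_covMat (V : Ω → Fin n → ℝ) : (covMat P V).IsSymm := by
  ext i j
  simp only [covMat, transpose_apply, of_apply]
  exact covariance_comm _ _

/-- The quadratic form at `v` is the variance of the portfolio with weights `v`. -/
theorem posSemidef_covMat [IsProbabilityMeasure P] {V : Ω → Fin n → ℝ}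
    (hV : ∀ i, MemLp (fun ω => V ω i) 2 P) : (covMat P V).PosSemidef := by
  refine PosSemidef.of_dotProduct_mulVec_nonneg ?_ fun v => ?_
  · rw [IsHermitian, conjTranspose_eq_transpose_of_trivial]
    exact isSymm_covMat V
  · have hvV : ∀ i, MemLp (fun ω => v i * V ω i) 2 P := fun i => (hV i).const_mul (v i)
    have h1 : v ⬝ᵥ (covMat P V *ᵥ v) = Var[fun ω => ∑ i, v i * V ω i; P] := by
      rw [← covariance_self (memLp_finsetSum _ fun i _ => hvV i).aemeasurable,
        covariance_fun_sum_fun_sum hvV hvV, dotProduct_mulVec_eq_sum,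
        ← Finset.univ_product_univ, Finset.sum_product]
      refine Finset.sum_congr rfl fun i _ => Finset.sum_congr rfl fun j _ => ?_
      rw [covariance_const_mul_left, covariance_const_mul_right, covMat, of_apply]
      ring
    rw [star_trivial, h1]
    exact variance_nonneg _ _

/-- Multiplying out the two factors separates the allocation from the level. Writing the four terms
as a sum over `Fin 4` makes the linearity lemmas applicable. -/
theorem tailIntegral_moment₂ (hfL : RegularDensity fL) (φ : Fin n → ℝ) (x : Fin n × Fin n) :
    tailIntegral (moment₂ fL φ x) = fun y => ∑ k : Fin 4,
      ![1, -φ x.1, -φ x.2, φ x.1 * φ x.2] k * ![tailIntegral (moment₂ fL 0 x),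
        tailIntegral (moment₁ fL 0 x.2), tailIntegral (moment₁ fL 0 x.1), tailIntegral fL] k y := by
  funext y
  have h := tailIntegral_sum (n := n) ![1, -φ x.1, -φ x.2, φ x.1 * φ x.2]
    (p := ![moment₂ fL 0 x, moment₁ fL 0 x.2, moment₁ fL 0 x.1, fL]) (fun k => by
      fin_cases k
      · exact (hfL.integrableC2_moment₂ 0 x).integrable
      · exact (hfL.integrableC2_moment₁ 0 x.2).integrable
      · exact (hfL.integrableC2_moment₁ 0 x.1).integrable
      · exact hfL.integrableC2.integrable) y
  have h2 : moment₂ fL φ x = fun u => ∑ k : Fin 4, ![1, -φ x.1, -φ x.2, φ x.1 * φ x.2] k *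
      ![moment₂ fL 0 x, moment₁ fL 0 x.2, moment₁ fL 0 x.1, fL] k u := by
    funext u
    simp [Fin.sum_univ_four, moment₂, moment₁]
    ring
  rw [h2, h]
  simp [Fin.sum_univ_four]

theorem iteratedDeriv_tailIntegral_moment₂ (hfL : RegularDensity fL) (i₀ : Fin n)
    (φ : Fin n → ℝ) (x : Fin n × Fin n) (y : ℝ) :
    iteratedDeriv 2 (tailIntegral (moment₂ fL φ x)) y =
      iteratedDeriv 2 (tailIntegral (moment₂ fL 0 x)) y
      - φ x.1 * iteratedDeriv 2 (tailIntegral (moment₁ fL 0 x.2)) y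
      - φ x.2 * iteratedDeriv 2 (tailIntegral (moment₁ fL 0 x.1)) y
      + φ x.1 * φ x.2 * iteratedDeriv 2 (tailIntegral fL) y := by
  have hT := dotCLM_one_single i₀
  rw [tailIntegral_moment₂ hfL, iteratedDeriv_two_sum_mul _ (fun k => by
    fin_cases k
    · exact (hfL.integrableC2_moment₂ 0 x).contDiff_halfSpaceIntegral hT
    · exact (hfL.integrableC2_moment₁ 0 x.2).contDiff_halfSpaceIntegral hT
    · exact (hfL.integrableC2_moment₁ 0 x.1).contDiff_halfSpaceIntegral hT
    · exact hfL.integrableC2.contDiff_halfSpaceIntegral hT)]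
  simp [Fin.sum_univ_four]
  ring

theorem quadK_zero_sub (A : Matrix (Fin n) (Fin n) ℝ) :
    quadK P L A L = quadK P L A fun ω => 0 - L ω := by
  funext y
  simp only [quadK, zero_sub, mulVec_neg, neg_dotProduct, dotProduct_neg, neg_neg]

/-- The second-order expansion as a quadratic function of the allocation. -/
theorem StandingAssumptions.secondOrderVaR_eq [IsProbabilityMeasure P]
    (h : StandingAssumptions P X L fL) (hfL : RegularDensity fL) (i₀ : Fin n)
    {A : Matrix (Fin n) (Fin n) ℝ} (hA : A.IsSymm) (q : ℝ) (φ : Fin n → ℝ) :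
    secondOrderVaR P L A q φ = q - 1 / (2 * totalDensity P L q) *
      (φ ⬝ᵥ (A *ᵥ φ) * deriv (totalDensity P L) q
        + 2 * ((A *ᵥ φ) ⬝ᵥ iteratedDeriv 2 (claimK P L) q) - iteratedDeriv 2 (quadK P L A L) q) := by
  have hquad : iteratedDeriv 2 (quadK P L A fun ω => φ - L ω) q =
      iteratedDeriv 2 (quadK P L A L) q - 2 * ((A *ᵥ φ) ⬝ᵥ iteratedDeriv 2 (claimK P L) q)
      - φ ⬝ᵥ (A *ᵥ φ) * deriv (totalDensity P L) q := by
    set k := iteratedDeriv 2 (claimK P L) q with hk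
    have hki : ∀ i, iteratedDeriv 2 (tailIntegral (moment₁ fL 0 i)) q = k i := fun i =>
      (h.iteratedDeriv_claimK hfL i₀ q i).symm
    -- The cross terms of the second moments come in two orders; symmetry of `A` identifies both
    -- with the same pairing, whence the factor 2.
    have e1 : (A *ᵥ φ) ⬝ᵥ k = ∑ x : Fin n × Fin n, A x.1 x.2 * (k x.1 * φ x.2) := by
      rw [dotProduct_comm, dotProduct_mulVec_eq_sum]
    have e2 : (A *ᵥ φ) ⬝ᵥ k = ∑ x : Fin n × Fin n, A x.1 x.2 * (φ x.1 * k x.2) := by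
      rw [dotProduct_comm, dotProduct_mulVec_comm_of_isSymm hA, dotProduct_mulVec_eq_sum]
    rw [quadK_zero_sub, h.iteratedDeriv_quadK hfL i₀ A 0, h.iteratedDeriv_quadK hfL i₀,
      h.deriv_totalDensity hfL i₀, two_mul, dotProduct_mulVec_eq_sum φ φ]
    nth_rw 1 [e1]
    rw [e2, Finset.sum_mul, ← Finset.sum_add_distrib, ← Finset.sum_sub_distrib,
      ← Finset.sum_sub_distrib]
    refine Finset.sum_congr rfl fun x _ => ?_
    rw [iteratedDeriv_tailIntegral_moment₂ hfL i₀, hki, hki]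
    ring
  have hf := (h.totalDensity_pos hfL i₀ q).ne'
  rw [secondOrderVaR, hquad]
  field_simp
  ring

/-- Completing the square: `K''(q) = -f'(q) φs` turns the linear term into the cross term of the
quadratic form centred at `φs`. -/
theorem StandingAssumptions.secondOrderVaR_eq_quadratic [IsProbabilityMeasure P]
    (h : StandingAssumptions P X L fL) (hfL : RegularDensity fL) (i₀ : Fin n)
    {A : Matrix (Fin n) (Fin n) ℝ} (hA : A.IsSymm) (q : ℝ) {φs : Fin n → ℝ}
    (hd : deriv (totalDensity P L) q ≠ 0)
    (hφs : φs = -((deriv (totalDensity P L) q)⁻¹ • iteratedDeriv 2 (claimK P L) q))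
    (φ : Fin n → ℝ) :
    secondOrderVaR P L A q φ = secondOrderVaR P L A q φs +
      -(deriv (totalDensity P L) q / (2 * totalDensity P L q)) *
        ((φ - φs) ⬝ᵥ (A *ᵥ (φ - φs))) := by
  have hf := (h.totalDensity_pos hfL i₀ q).ne'
  have hk : iteratedDeriv 2 (claimK P L) q = -(deriv (totalDensity P L) q) • φs := by
    rw [hφs, smul_neg, neg_smul, neg_neg, smul_smul, mul_inv_cancel₀ hd, one_smul]
  rw [h.secondOrderVaR_eq hfL i₀ hA, h.secondOrderVaR_eq hfL i₀ hA, hk]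
  simp only [dotProduct_smul, smul_eq_mul, mulVec_sub, dotProduct_sub, sub_dotProduct]
  rw [dotProduct_comm (A *ᵥ φ), dotProduct_comm (A *ᵥ φs),
    dotProduct_mulVec_comm_of_isSymm hA φ φs]
  field_simp
  ring

end

end SurplusRisk

open SurplusRisk in
theorem mainTheorem3 {Ω : Type*} [MeasurableSpace Ω] (P : Measure Ω) [IsProbabilityMeasure P]
    (n : ℕ) (hn : 1 ≤ n) (X L : Ω → Fin n → ℝ) (fL : (Fin n → ℝ) → ℝ)
    (hXL : StandingAssumptions P X L fL) (hfL : RegularDensity fL)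
    (κ : VolKind) (hκ : κ = VolKind.normal → ∀ i, MemLp (fun ω => X ω i) 2 P)
    (α : ℝ) (hα0 : 0 < α) (hα1 : α < 1)
    (q : ℝ) (hq : q = quantile P (totalClaim L) (1 - α)) :
    -- the objects in the expansion are well defined
    (valueAtRisk P α (fun ω => -totalClaim L ω) = q ∧
      P.map (totalClaim L) =
        volume.withDensity (fun y => ENNReal.ofReal (totalDensity P L y)) ∧
      ContDiff ℝ 1 (totalDensity P L) ∧ (∀ y, 0 < totalDensity P L y) ∧
      ContDiff ℝ 2 (claimK P L) ∧
      (∀ (A : Matrix (Fin n) (Fin n) ℝ) (φ : Fin n → ℝ),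
        ContDiff ℝ 2 (quadK P L A fun ω => φ - L ω)) ∧
      (∀ᶠ σ in 𝓝[>] (0 : ℝ),
        (0 < volatility κ P X → volatility κ P (assetFamily κ P X σ) = σ) ∧
        (∀ᵐ ω ∂P, ∀ i, 0 < assetFamily κ P X σ ω i) ∧
        ∀ i, MemLp (fun ω => assetFamily κ P X σ ω i) 2 P ∧
          ∫ ω, assetFamily κ P X σ ω i ∂P = 1)) ∧
    -- a) the expansion of the value-at-risk, in both forms
    (∀ φ : Fin n → ℝ,
      ((fun σ : ℝ => valueAtRisk P α (surplus (assetFamily κ P X σ) L φ)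
          - secondOrderVaR P L (covMat P (assetFamily κ P X σ)) q φ)
        =o[𝓝[>] 0] fun σ : ℝ => σ ^ 2) ∧
      ((fun σ : ℝ => valueAtRisk P α (surplus (assetFamily κ P X σ) L φ)
          - (q - 1 / (2 * totalDensity P L q) *
            (φ ⬝ᵥ (covMat P (assetFamily κ P X σ) *ᵥ φ) * deriv (totalDensity P L) q
              + 2 * ((covMat P (assetFamily κ P X σ) *ᵥ φ) ⬝ᵥ iteratedDeriv 2 (claimK P L) q)
              - iteratedDeriv 2 (quadK P L (covMat P (assetFamily κ P X σ)) L) q)))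
        =o[𝓝[>] 0] fun σ : ℝ => σ ^ 2) ∧
      ∀ σ : ℝ, secondOrderVaR P L (covMat P (assetFamily κ P X σ)) q φ =
        q - 1 / (2 * totalDensity P L q) *
          (φ ⬝ᵥ (covMat P (assetFamily κ P X σ) *ᵥ φ) * deriv (totalDensity P L) q
            + 2 * ((covMat P (assetFamily κ P X σ) *ᵥ φ) ⬝ᵥ iteratedDeriv 2 (claimK P L) q)
            - iteratedDeriv 2 (quadK P L (covMat P (assetFamily κ P X σ)) L) q)) ∧
    -- b) the optimal allocation of the second-order expansion
    (∀ σ : ℝ, 0 < σ → (∀ i, MemLp (fun ω => assetFamily κ P X σ ω i) 2 P) →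
      IsUnit (covMat P (assetFamily κ P X σ)) → deriv (totalDensity P L) q ≠ 0 →
      ∀ φs : Fin n → ℝ,
        φs = -((deriv (totalDensity P L) q)⁻¹ • iteratedDeriv 2 (claimK P L) q) →
        (∀ φ, HasFDerivAt (secondOrderVaR P L (covMat P (assetFamily κ P X σ)) q)
          (0 : (Fin n → ℝ) →L[ℝ] ℝ) φ ↔ φ = φs) ∧
        (deriv (totalDensity P L) q < 0 → ∀ φ, φ ≠ φs →
          secondOrderVaR P L (covMat P (assetFamily κ P X σ)) q φs <
            secondOrderVaR P L (covMat P (assetFamily κ P X σ)) q φ) ∧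
        (0 < deriv (totalDensity P L) q →
          (∀ φ, φ ≠ φs →
            secondOrderVaR P L (covMat P (assetFamily κ P X σ)) q φ <
              secondOrderVaR P L (covMat P (assetFamily κ P X σ)) q φs) ∧
          ¬ BddBelow (Set.range
            (secondOrderVaR P L (covMat P (assetFamily κ P X σ)) q)))) := by
  -- Any coordinate serves: `Pi.single i₀ 1` is the direction transversal to the hyperplanes ⟨1, ℓ⟩
  -- = y in which all derivatives are taken.
  have i₀ : Fin n := ⟨0, hn⟩
  have hsym : ∀ σ, (covMat P (assetFamily κ P X σ)).IsSymm := fun σ => isSymm_covMat _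
  have hmain := hXL.isLittleO_valueAtRisk hfL i₀ κ hκ hα0 hα1 hq
  refine ⟨⟨?_, hXL.map_totalClaim hfL i₀, hXL.contDiff_totalDensity hfL i₀,
    hXL.totalDensity_pos hfL i₀, hXL.contDiff_claimK hfL i₀, hXL.contDiff_quadK hfL i₀, ?_⟩,
    fun φ => ⟨hmain φ, ?_, fun σ => hXL.secondOrderVaR_eq hfL i₀ (hsym σ) q φ⟩,
    fun σ _ hL2 hunit hd φs hφs => ?_⟩
  · rw [hq, hXL.valueAtRisk_neg_totalClaim hfL]
  · obtain ⟨Z, hZ, hb⟩ := hXL.exists_assetBound κ hκ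
    filter_upwards [hb] with σ hσ
    exact ⟨hσ.volatility_eq, hσ.pos, fun i => ⟨hσ.memLp hXL.measurable_asset hZ i, hσ.mean i⟩⟩
  · simpa only [hXL.secondOrderVaR_eq hfL i₀ (hsym _) q φ] using hmain φ
  · have hf := hXL.totalDensity_pos hfL i₀ q
    have hA : (covMat P (assetFamily κ P X σ)).PosDef :=
      (posSemidef_covMat hL2).posDef_iff_isUnit.2 hunit
    -- The coefficient of the form is `-f'(q) / (2 f(q))` with `f(q) > 0`, so the sign of `f'(q)`
    -- decides between minimum and maximum.
    have hV := hXL.secondOrderVaR_eq_quadratic hfL i₀ (hsym σ) q hd hφs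
    refine ⟨hasFDerivAt_zero_iff_of_eq_quadratic hA
      (neg_ne_zero.2 (div_ne_zero hd (by positivity))) hV, fun hneg φ hφ => ?_,
      fun hpos => ?_⟩
    · exact lt_of_eq_quadratic hA
        (neg_pos.2 (div_neg_of_neg_of_pos hneg (by positivity))) hV hφ
    · have hb : -(deriv (totalDensity P L) q / (2 * totalDensity P L q)) < 0 :=
        neg_neg_of_pos (by positivity)
      exact ⟨fun φ hφ => lt_of_eq_neg_quadratic hA hb hV hφ,
        not_bddBelow_of_eq_neg_quadratic i₀ hA hb hV⟩
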